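/- Let $q\ge 1$ be an integer and let $X=(VX,EX)$ be a countable simple graph that is $(q+1)$-regular. Let $\Gamma$ be a group of automorphisms of $X$ that acts freely on $X$ (no element other than the identity fixes a vertex or a geometric edge) and has finitely many orbits on $VX$. Let $B=X/\Gamma$ be the quotient graph, with vertex set $VB$ and set of geometric edges $EB$, let $\chi(B)=|VB|-|EB|$, and let $\mathcal F\subset VX$ be a set of representatives of $VX/\Gamma$. Let $A$ be the adjacency operator on $\ell^2(VX)$, $Q=\mathrm{diag}(\deg(v)-1)$, and $\Delta(u)=(1+qu^2)I-uA$ for $u\in\mathbb C$. *Trace and determinant.* Let $\mathcal N(X,\Gamma)$ be the von Neumann algebra of bounded operators on $\ell^2(VX)$ that commute with $(\lambda(\gamma)f)(x)=f(\gamma^{-1}x)$, $\gamma\in\Gamma$, with the trace $\mathrm{Tr}_\Gamma(T)=\sum_{x\in\mathcal F}T(x,x)$, and put $\chi^{(2)}(X)=-\tfrac12\mathrm{Tr}_\Gamma(Q-I)$. For $T\in\mathcal N(X,\Gamma)$ with $0\notin\mathrm{conv}\,\sigma(T)$ put $$\det\nolimits_\Gamma(T)=\exp\Bigl(\mathrm{Tr}_\Gamma\Bigl(\frac1{2\pi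 i}\int_{\partial D}\log\lambda\,(\lambda-T)^{-1}\,d\lambda\Bigr)\Bigr),$$ where $D\supset\mathrm{conv}\,\sigma(T)$ is an open disc whose closure does not contain $0$, and $\log$ is a branch of the logarithm on $\overline D$ (the value does not depend on these choices). *Zeta function.* A closed path of length $m\ge1$ is a sequence $(v_0,\dots,v_m=v_0)$ of vertices with $v_i\sim v_{i+1}$. It is reduced if it has no backtracking ($v_{i-1}\ne v_{i+1}$ for $1\le i\le m-1$) and no tail (there is no $k$ with $1\le k\le[m/2]-1$ and $v_j=v_{m-j}$ for $1\le j\le k$). It is primitive if it is not obtained by going $n\ge2$ times around another closed path. A prime cycle is a class of primitive reduced closed paths modulo cyclic shifts of the origin. For a prime cycle $C$ let $|C|$ be its length and $\Gamma_C$ its stabilizer in $\Gamma$. Define $$Z_{X,\Gamma}(u)=\prod_{[C]_\Gamma}(1-u^{|C|})^{-1/|\Gamma_C|},$$ the product running over the $\Gamma$-orbits of prime cycles, with the principal branch of the power. Let $$\Omega=\mathbb R^2\setminus\Bigl(\bigl\{(x,y):x^2+y^2=\tfrac1q\bigr\}\cup\bigl\{(x,0):\tfrac1q\le|x|\le1\bigr\}\Bigr)\subset\mathbb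 C .$$ Then $\Delta(u)\in\mathcal N(X,\Gamma)$ for all $u\in\mathbb C$, and: 1. $\chi^{(2)}(X)=\chi(B)=|VB|(1-q)/2\in\mathbb Z$. 2. For $|u|<1/q$ the product defining $Z_{X,\Gamma}(u)$ converges unconditionally and $Z_{X,\Gamma}(u)=(1-u^2)^{\chi(B)}\det_\Gamma(\Delta(u))^{-1}$. 3. The set $\Omega$ is open and contains $\{|u|<1/q\}$; for every $u\in\Omega$ we have $0\notin\mathrm{conv}\,\sigma(\Delta(u))$, so that $\det_\Gamma(\Delta(u))$ is defined; and $u\mapsto(1-u^2)^{\chi(B)}\det_\Gamma(\Delta(u))^{-1}$ is holomorphic on $\Omega$. Thus the formula in 2 extends $Z_{X,\Gamma}$ to a holomorphic function on $\Omega$. 4. For every $u\in\Omega\setminus\{0\}$ we have $\frac1{qu}\in\Omega$ and $\det_\Gamma\bigl(\Delta(\tfrac1{qu})\bigr)=(qu^2)^{-|VB|}\det_\Gamma(\Delta(u))$. -/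

import Mathlib

noncomputable section

namespace PeriodicGraph

variable {V : Type*}

/-! ### Closed paths, cycles and prime cycles -/

/-- A closed path `(v₀, …, v_m = v₀)` of length `m ≥ 1` in a simple graph. The vertices are indexed
by all natural numbers, the index being read modulo `m`; thus `vert` is determined by its first
`m + 1` values, and any closed sequence of successively adjacent vertices occurs. -/
@[ext]
structure ClosedPath (G : SimpleGraph V) where
  /-- the length `m` -/
  len : ℕ
  len_pos : 0 < len
  /-- the vertex `v_j` -/
  vert : ℕ → V
  periodic : ∀ j, vert (j + len) = vert j
  adj : ∀ j, G.Adj (vert j) (vert (j + 1))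

namespace ClosedPath

variable {G : SimpleGraph V}

/-- `v_{i-1} = v_{i+1}` for some `1 ≤ i ≤ m - 1`. -/
def HasBacktracking (C : ClosedPath G) : Prop :=
  ∃ i, 1 ≤ i ∧ i + 1 ≤ C.len ∧ C.vert (i - 1) = C.vert (i + 1)

/-- `v_j = v_{m-j}` for `j = 1, …, k`, for some `1 ≤ k ≤ [m/2] - 1`. -/
def HasTail (C : ClosedPath G) : Prop :=
  ∃ k, 1 ≤ k ∧ k + 1 ≤ C.len / 2 ∧ ∀ j, 1 ≤ j → j ≤ k → C.vert j = C.vert (C.len - j)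

/-- Closed paths without backtracking and without tail. -/
def IsReduced (C : ClosedPath G) : Prop := ¬ C.HasBacktracking ∧ ¬ C.HasTail

/-- `C` is not obtained by going `n ≥ 2` times around some closed path `D`. -/
def IsPrimitive (C : ClosedPath G) : Prop :=
  ¬ ∃ (D : ClosedPath G) (n : ℕ), 2 ≤ n ∧ C.len = n * D.len ∧ ∀ j, C.vert j = D.vert j

/-- An automorphism of the graph maps closed paths to closed paths. -/
instance : MulAction (G ≃g G) (ClosedPath G) where
  smul γ C :=
    { len := C.len
      len_pos := C.len_pos
      vert := fun j => γ (C.vert j)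
      periodic := fun j => by rw [C.periodic j]
      adj := fun j => (RelIso.map_rel_iff γ).2 (C.adj j) }
  one_smul _ := rfl
  mul_smul _ _ _ := rfl

theorem vert_smul (γ : G ≃g G) (C : ClosedPath G) (j : ℕ) : (γ • C).vert j = γ (C.vert j) := rfl

theorem len_smul (γ : G ≃g G) (C : ClosedPath G) : (γ • C).len = C.len := rfl

theorem vert_add_mul (C : ClosedPath G) (j n : ℕ) : C.vert (j + n * C.len) = C.vert j := by
  induction n with
  | zero => simp
  | succ n ih => rw [Nat.succ_mul, ← Nat.add_assoc, C.periodic, ih]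

/-- Two closed paths are equivalent if they differ by a shift of the origin. -/
instance setoid (G : SimpleGraph V) : Setoid (ClosedPath G) where
  r C D := D.len = C.len ∧ ∃ k, ∀ j, D.vert j = C.vert (j + k)
  iseqv :=
    { refl := fun _ => ⟨rfl, 0, fun _ => rfl⟩
      symm := by
        rintro C D ⟨h, k, hk⟩
        refine ⟨h.symm, k * C.len - k, fun j => ?_⟩
        have h1 : k ≤ k * C.len := Nat.le_mul_of_pos_right k C.len_pos
        rw [hk, Nat.add_assoc, Nat.sub_add_cancel h1, vert_add_mul]
      trans := by
        rintro C D E ⟨h, k, hk⟩ ⟨h', k', hk'⟩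
        exact ⟨h'.trans h, k' + k, fun j => by rw [hk', hk, Nat.add_assoc]⟩ }

end ClosedPath

/-- Cycles: closed paths up to the choice of the origin. -/
def Cycle (G : SimpleGraph V) : Type _ := Quotient (ClosedPath.setoid G)

namespace Cycle

variable {G : SimpleGraph V}

/-- The length of a cycle. -/
def len : Cycle G → ℕ := Quotient.lift ClosedPath.len fun _ _ h => h.1.symm

/-- The action of graph automorphisms on cycles. -/
instance : MulAction (G ≃g G) (Cycle G) where
  smul γ := Quotient.map (fun C => γ • C)
    (by rintro C D ⟨h, k, hk⟩; exact ⟨h, k, fun j => congrArg γ (hk j)⟩)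
  one_smul := by rintro ⟨C⟩; rfl
  mul_smul := by rintro γ δ ⟨C⟩; rfl

/-- Prime cycles: the classes of primitive reduced closed paths. -/
def IsPrime (c : Cycle G) : Prop :=
  ∃ C : ClosedPath G, C.IsReduced ∧ C.IsPrimitive ∧ Quotient.mk (ClosedPath.setoid G) C = c

end Cycle

/-- The set of prime cycles. -/
def PrimeCycle (G : SimpleGraph V) : Type _ := {c : Cycle G // c.IsPrime}

/-! ### The zeta function of a graph with a group of automorphisms -/

section Zeta

variable {G : SimpleGraph V} (Γ : Subgroup (G ≃g G))

/-- `Γ`-equivalence of prime cycles. -/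
def primeSetoid : Setoid (PrimeCycle G) where
  r c d := ∃ γ ∈ Γ, γ • c.1 = d.1
  iseqv :=
    { refl := fun c => ⟨1, Γ.one_mem, one_smul _ c.1⟩
      symm := by
        rintro c d ⟨γ, hγ, h⟩
        exact ⟨γ⁻¹, Γ.inv_mem hγ, by rw [← h, inv_smul_smul]⟩
      trans := by
        rintro c d e ⟨γ, hγ, h⟩ ⟨δ, hδ, h'⟩
        exact ⟨δ * γ, Γ.mul_mem hδ hγ, by rw [mul_smul, h, h']⟩ }

/-- `Γ`-equivalence classes of prime cycles. -/
def PrimeClass : Type _ := Quotient (primeSetoid Γ)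

/-- The factor `(1 - u^|C|)^(-1/|Γ_C|)` (principal branch), where `Γ_C` is the stabilizer of the
cycle `C` in `Γ`. It only depends on the `Γ`-class of `C`, so a representative is chosen. -/
def zetaFactor (u : ℂ) (c : PrimeClass Γ) : ℂ :=
  let C : Cycle G := (Quotient.out c : PrimeCycle G).1
  (1 - u ^ C.len) ^ (-(1 / (Nat.card (MulAction.stabilizer Γ C) : ℂ)))

/-- The Ihara zeta function, as an (unconditional) infinite product. -/
def zeta (u : ℂ) : ℂ := ∏' c : PrimeClass Γ, zetaFactor Γ u c

/-! ### Free actions and the quotient graph -/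

/-- No element of `Γ` other than the identity fixes a vertex or a geometric edge of the graph
(that is, `Γ` acts freely on the graph as a one-dimensional complex). -/
def ActsFreely : Prop :=
  ∀ γ ∈ Γ, γ ≠ 1 → (∀ v, γ v ≠ v) ∧ ∀ e ∈ G.edgeSet, Sym2.map γ e ≠ e

/-- Two vertices are equivalent if they lie in the same `Γ`-orbit. -/
def vertexSetoid : Setoid V where
  r x y := ∃ γ ∈ Γ, γ x = y
  iseqv :=
    { refl := fun _ => ⟨1, Γ.one_mem, rfl⟩
      symm := by
        rintro x y ⟨γ, hγ, h⟩
        exact ⟨γ⁻¹, Γ.inv_mem hγ, by rw [← h, RelIso.inv_apply_self]⟩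
      trans := by
        rintro x y z ⟨γ, hγ, h⟩ ⟨δ, hδ, h'⟩
        exact ⟨δ * γ, Γ.mul_mem hδ hγ, by rw [RelIso.mul_apply, h, h']⟩ }

/-- Two geometric edges are equivalent if they lie in the same `Γ`-orbit. -/
def edgeSetoid : Setoid G.edgeSet where
  r e f := ∃ γ ∈ Γ, Sym2.map γ e.1 = f.1
  iseqv :=
    { refl := fun e => ⟨1, Γ.one_mem, by rw [RelIso.coe_one, Sym2.map_id]; rfl⟩
      symm := by
        rintro e f ⟨γ, hγ, h⟩
        refine ⟨γ⁻¹, Γ.inv_mem hγ, ?_⟩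
        rw [← h, Sym2.map_map, ← RelIso.coe_mul, inv_mul_cancel, RelIso.coe_one, Sym2.map_id]; rfl
      trans := by
        rintro e f g ⟨γ, hγ, h⟩ ⟨δ, hδ, h'⟩
        exact ⟨δ * γ, Γ.mul_mem hδ hγ, by rw [RelIso.coe_mul, ← Sym2.map_map, h, h']⟩ }

/-- The vertices `VB` of the quotient graph `B = X/Γ`. -/
def QuotVertex : Type _ := Quotient (vertexSetoid Γ)

/-- The geometric edges `EB` of the quotient graph `B = X/Γ`. -/
def QuotEdge : Type _ := Quotient (edgeSetoid Γ)

/-- The Euler characteristic `χ(B) = |VB| - |EB|` of the quotient graph. -/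
def eulerChar : ℤ := (Nat.card (QuotVertex Γ) : ℤ) - (Nat.card (QuotEdge Γ) : ℤ)

/-- `F` contains exactly one vertex from every `Γ`-orbit. -/
def IsRepresentatives (F : Finset V) : Prop := ∀ x : V, ∃! y, y ∈ F ∧ ∃ γ ∈ Γ, γ x = y

end Zeta

/-! ### Operators on `ℓ²(V)` -/

/-- The Hilbert space `ℓ²(V)`. -/
abbrev L2 (V : Type*) := lp (fun _ : V => ℂ) 2

theorem memL2_iff (f : V → ℂ) :
    Memℓp (E := fun _ : V => ℂ) f 2 ↔ ∑' x, ‖f x‖ₑ ^ 2 ≠ ⊤ := by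
  have h : ∀ x, ‖f x‖ₑ ^ 2 = ENNReal.ofReal (‖f x‖ ^ 2) := fun x => by
    rw [← ofReal_norm, ENNReal.ofReal_pow (norm_nonneg _)]
  have h2 : Memℓp (E := fun _ : V => ℂ) f 2 ↔ Summable fun x => ‖f x‖ ^ 2 := by
    rw [memℓp_gen_iff (by norm_num)]
    simp
  simp_rw [h]
  rw [h2]
  refine ⟨fun hs => hs.tsum_ofReal_ne_top, fun hs => ?_⟩
  have := ENNReal.summable_toReal hs
  simpa [ENNReal.toReal_ofReal, sq_nonneg] using this

theorem enorm_sq_eq (f : L2 V) : ∑' x, ‖f x‖ₑ ^ 2 = ENNReal.ofReal (‖f‖ ^ 2) := by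
  have h : ∀ x, ‖f x‖ₑ ^ 2 = ENNReal.ofReal (‖f x‖ ^ 2) := fun x => by
    rw [← ofReal_norm, ENNReal.ofReal_pow (norm_nonneg _)]
  have hs : HasSum (fun x => ‖f x‖ ^ 2) (‖f‖ ^ 2) := by
    simpa using lp.hasSum_norm (p := 2) (by norm_num) f
  simp_rw [h]
  rw [← ENNReal.ofReal_tsum_of_nonneg (fun x => sq_nonneg _) hs.summable, hs.tsum_eq]

/-- A linear map on functions that is bounded for the `ℓ²` norm gives a bounded operator. -/
def opOfBound (T : (V → ℂ) →ₗ[ℂ] (V → ℂ)) (c : ℝ)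
    (h : ∀ f : V → ℂ, ∑' x, ‖T f x‖ₑ ^ 2 ≤ ENNReal.ofReal (c ^ 2) * ∑' x, ‖f x‖ₑ ^ 2) :
    L2 V →L[ℂ] L2 V :=
  LinearMap.mkContinuous
    { toFun := fun f => ⟨T f, (memL2_iff _).2 <| ne_top_of_le_ne_top
        (ENNReal.mul_ne_top ENNReal.ofReal_ne_top ((memL2_iff _).1 (lp.memℓp f))) (h f)⟩
      map_add' := fun f g => lp.ext (T.map_add f g)
      map_smul' := fun a f => lp.ext (T.map_smul a f) }
    |c| (by
      intro f
      rw [← abs_of_nonneg (norm_nonneg f), ← abs_mul]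
      refine abs_le_of_sq_le_sq' ?_ (abs_nonneg _) |>.2
      have h1 := h f
      rw [enorm_sq_eq, ← ENNReal.ofReal_mul (sq_nonneg c)] at h1
      rw [sq_abs, mul_pow]
      refine (ENNReal.ofReal_le_ofReal_iff (by positivity)).1 (le_trans (le_of_eq ?_) h1)
      exact (enorm_sq_eq _).symm)

theorem opOfBound_apply (T : (V → ℂ) →ₗ[ℂ] (V → ℂ)) (c : ℝ)
    (h : ∀ f : V → ℂ, ∑' x, ‖T f x‖ₑ ^ 2 ≤ ENNReal.ofReal (c ^ 2) * ∑' x, ‖f x‖ₑ ^ 2)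
    (f : L2 V) (x : V) : opOfBound T c h f x = T f x := rfl

section Operators

variable (G : SimpleGraph V) [G.LocallyFinite]

theorem adj_bound (d : ℕ) (hd : ∀ v, G.degree v ≤ d) (f : V → ℂ) :
    ∑' x, ‖∑ y ∈ G.neighborFinset x, f y‖ₑ ^ 2 ≤
      ENNReal.ofReal ((d : ℝ) ^ 2) * ∑' x, ‖f x‖ₑ ^ 2 := by
  classical
  have h1 : ∀ x, ‖∑ y ∈ G.neighborFinset x, f y‖ₑ ^ 2 ≤
      d * ∑' y, if G.Adj x y then ‖f y‖ₑ ^ 2 else 0 := by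
    intro x
    have ha : ∑' y, (if G.Adj x y then ‖f y‖ₑ ^ 2 else 0) =
        ∑ y ∈ G.neighborFinset x, ‖f y‖ₑ ^ 2 := by
      rw [tsum_eq_sum (s := G.neighborFinset x)]
      · exact Finset.sum_congr rfl fun y hy => if_pos ((G.mem_neighborFinset x y).1 hy)
      · exact fun y hy => if_neg fun h => hy ((G.mem_neighborFinset x y).2 h)
    have hb : ‖∑ y ∈ G.neighborFinset x, f y‖ ^ 2 ≤
        d * ∑ y ∈ G.neighborFinset x, ‖f y‖ ^ 2 := by
      calc ‖∑ y ∈ G.neighborFinset x, f y‖ ^ 2 ≤ (∑ y ∈ G.neighborFinset x, ‖f y‖) ^ 2 := by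
            gcongr; exact norm_sum_le _ _
        _ ≤ G.degree x * ∑ y ∈ G.neighborFinset x, ‖f y‖ ^ 2 := sq_sum_le_card_mul_sum_sq
        _ ≤ d * ∑ y ∈ G.neighborFinset x, ‖f y‖ ^ 2 := by
            gcongr; exact hd x
    have hc := ENNReal.ofReal_le_ofReal hb
    rw [ENNReal.ofReal_mul (by positivity), ENNReal.ofReal_natCast,
      ENNReal.ofReal_sum_of_nonneg fun _ _ => sq_nonneg _, ENNReal.ofReal_pow (norm_nonneg _),
      ofReal_norm] at hc
    rw [ha]
    refine hc.trans (le_of_eq ?_)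
    congr 1
    exact Finset.sum_congr rfl fun y _ => by
      rw [ENNReal.ofReal_pow (norm_nonneg _), ofReal_norm]
  have h2 : ∀ y, ∑' x, (if G.Adj x y then ‖f y‖ₑ ^ 2 else 0) ≤ d * ‖f y‖ₑ ^ 2 := by
    intro y
    rw [tsum_eq_sum (s := G.neighborFinset y)]
    · calc ∑ x ∈ G.neighborFinset y, (if G.Adj x y then ‖f y‖ₑ ^ 2 else 0)
          ≤ ∑ x ∈ G.neighborFinset y, ‖f y‖ₑ ^ 2 :=
            Finset.sum_le_sum fun x _ => by split_ifs <;> simp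
        _ = G.degree y * ‖f y‖ₑ ^ 2 := by
            rw [Finset.sum_const, nsmul_eq_mul, SimpleGraph.card_neighborFinset_eq_degree]
        _ ≤ d * ‖f y‖ₑ ^ 2 := by
            gcongr; exact hd y
    · exact fun x hx => if_neg fun h => hx ((G.mem_neighborFinset y x).2 h.symm)
  calc ∑' x, ‖∑ y ∈ G.neighborFinset x, f y‖ₑ ^ 2
      ≤ ∑' x, d * ∑' y, (if G.Adj x y then ‖f y‖ₑ ^ 2 else 0) := ENNReal.tsum_le_tsum h1
    _ = d * ∑' y, ∑' x, (if G.Adj x y then ‖f y‖ₑ ^ 2 else 0) := by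
        rw [ENNReal.tsum_mul_left, ENNReal.tsum_comm]
    _ ≤ d * ∑' y, d * ‖f y‖ₑ ^ 2 := by
        gcongr with y; exact h2 y
    _ = ENNReal.ofReal ((d : ℝ) ^ 2) * ∑' x, ‖f x‖ₑ ^ 2 := by
        rw [ENNReal.tsum_mul_left, ← mul_assoc, ENNReal.ofReal_pow (by positivity),
          ENNReal.ofReal_natCast, sq]

/-- The adjacency operator `(A f)(x) = ∑_{y ∼ x} f(y)` on `ℓ²(V)`, for a graph whose degrees are
bounded by `d`. -/
def adjOp (d : ℕ) (hd : ∀ v, G.degree v ≤ d) : L2 V →L[ℂ] L2 V :=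
  opOfBound
    { toFun := fun f x => ∑ y ∈ G.neighborFinset x, f y
      map_add' := fun _ _ => funext fun _ => Finset.sum_add_distrib
      map_smul' := fun _ _ => funext fun _ => (Finset.mul_sum _ _ _).symm }
    d (adj_bound G d hd)

/-- The operator `Q = diag(deg(v) - 1)` on `ℓ²(V)`, for a graph whose degrees are bounded by `d`. -/
def degOp (d : ℕ) (hd : ∀ v, G.degree v ≤ d) : L2 V →L[ℂ] L2 V :=
  opOfBound
    { toFun := fun f x => ((G.degree x : ℂ) - 1) * f x
      map_add' := fun _ _ => funext fun _ => mul_add _ _ _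
      map_smul' := fun _ _ => funext fun _ => mul_left_comm _ _ _ }
    (d + 1) (by
      intro f
      rw [← ENNReal.tsum_mul_left]
      refine ENNReal.tsum_le_tsum fun x => ?_
      have hx : (G.degree x : ℝ) ≤ d := by exact_mod_cast hd x
      have h1 : ‖(G.degree x : ℂ) - 1‖ ≤ d + 1 := by
        refine (norm_sub_le _ _).trans ?_
        simpa using hx
      have h2 : ‖(G.degree x : ℂ) - 1‖ₑ ≤ ENNReal.ofReal (d + 1) := by
        rw [← ofReal_norm]
        exact ENNReal.ofReal_le_ofReal h1
      change ‖((G.degree x : ℂ) - 1) * f x‖ₑ ^ 2 ≤ _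
      rw [enorm_mul, mul_pow, ENNReal.ofReal_pow (by positivity)]
      gcongr)

end Operators

section Determinant

/-- The unitary `(λ(γ) f)(x) = f(γ⁻¹ x)` on `ℓ²(V)`. -/
def regRep {G : SimpleGraph V} (γ : G ≃g G) : L2 V →L[ℂ] L2 V :=
  opOfBound
    { toFun := fun f x => f (γ⁻¹ x)
      map_add' := fun _ _ => rfl
      map_smul' := fun _ _ => rfl }
    1 (by
      intro f
      have h := (RelIso.toEquiv γ⁻¹).tsum_eq fun x => ‖f x‖ₑ ^ 2
      simpa using h.le)

/-- The von Neumann algebra `𝒩(X, Γ) = {λ(γ) : γ ∈ Γ}'` of bounded operators on `ℓ²(V)` that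
commute with the action of `Γ`. -/
def groupAlg {G : SimpleGraph V} (Γ : Subgroup (G ≃g G)) : Subalgebra ℂ (L2 V →L[ℂ] L2 V) :=
  Subalgebra.centralizer ℂ {T | ∃ γ ∈ Γ, T = regRep γ}

open Classical in
/-- The trace `Tr_Γ(T) = ∑_{x ∈ F} T(x, x)`, with `F` a set of representatives of the vertices
modulo `Γ`. -/
def trace (F : Finset V) (T : L2 V →L[ℂ] L2 V) : ℂ :=
  ∑ x ∈ F, T (lp.single 2 x (1 : ℂ)) x

/-- The `L²`-Euler characteristic `-½ Tr_Γ(Q - I)` of a graph whose degrees are bounded by `d`. -/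
def l2EulerChar (G : SimpleGraph V) [G.LocallyFinite] (d : ℕ) (hd : ∀ v, G.degree v ≤ d)
    (F : Finset V) : ℂ :=
  -(1 / 2) * trace F (degOp G d hd - 1)

variable {H : Type*} [NormedAddCommGroup H] [NormedSpace ℂ H]

/-- The data needed to form `log T`: a disc `Ω` containing `conv σ(T)` and a branch `log` of the
logarithm on the closure of `Ω`. Since a compact convex set that misses the origin lies in a disc
whose closure misses the origin, such data exist precisely when `0 ∉ conv σ(T)`. -/
structure LogData (T : H →L[ℂ] H) where
  center : ℂ
  radius : ℝ
  radius_pos : 0 < radius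
  conv_subset : convexHull ℝ (spectrum ℂ T) ⊆ Metric.ball center radius
  /-- the branch of the logarithm -/
  log : ℂ → ℂ
  log_continuousOn : ContinuousOn log (Metric.closedBall center radius)
  exp_log : ∀ z ∈ Metric.closedBall center radius, Complex.exp (log z) = z

/-- `(2πi)⁻¹ ∫_{∂Ω} log λ (λ - T)⁻¹ dλ`. -/
def LogData.logOp {T : H →L[ℂ] H} (D : LogData T) : H →L[ℂ] H :=
  (2 * Real.pi * Complex.I : ℂ)⁻¹ • ∮ z in C(D.center, D.radius), D.log z • resolvent T z

open Classical in
/-- The analytic determinant `det_τ(T) = exp (τ (log T))`, defined for `0 ∉ conv σ(T)`. The value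
does not depend on the chosen disc and branch. Where it is not defined the value is `0`. -/
def analyticDet (τ : (H →L[ℂ] H) → ℂ) (T : H →L[ℂ] H) : ℂ :=
  if h : Nonempty (LogData T) then Complex.exp (τ h.some.logOp) else 0

end Determinant

section Regular

variable (G : SimpleGraph V) [G.LocallyFinite]

/-- `Δ(u) = (1 + q u²) I - u A` for a `(q+1)`-regular graph. -/
def deformedLaplacian (q : ℕ) (hG : G.IsRegularOfDegree (q + 1)) (u : ℂ) : L2 V →L[ℂ] L2 V :=
  (1 + q * u ^ 2) • (1 : L2 V →L[ℂ] L2 V) - u • adjOp G (q + 1) fun v => (hG v).le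

end Regular

/-- The plane minus the circle `|u| = 1/√q` and the real segments `1/q ≤ |x| ≤ 1`. -/
def holomorphyDomain (q : ℕ) : Set ℂ :=
  ({u : ℂ | u.re ^ 2 + u.im ^ 2 = 1 / (q : ℝ)} ∪
    {u : ℂ | u.im = 0 ∧ 1 / (q : ℝ) ≤ |u.re| ∧ |u.re| ≤ 1})ᶜ

end PeriodicGraph

end

/-! Everything about the determinant comes from one measure. The adjacency operator A is
self-adjoint with spectrum in I = [-(q+1), q+1], so Riesz–Markov gives a measure μ of mass |F| with
Tr_Γ f(A) = ∫ f dμ (`exists_traceMeasure`). Moreover Δ(u) = p_u(A) with p_u(x) = 1 + qu² - ux affine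
in x. Hence conv σ(Δ(u)) lies in the segment p_u(I), which misses 0 when u ∈ Ω, because a zero of
p_u in I puts u on the circle or on the real segments (`symbol_ne_zero`). Cauchy's formula then
gives det_Γ Δ(u) = exp ∫ l dμ for every continuous logarithm l of p_u on I: two of them differ on I
by a constant 2πik, and the mass of μ is an integer (`analyticDet_cfc`). Differentiation under the
integral yields holomorphy on Ω, and p_{1/(qu)} = p_u/(qu²) yields the functional equation.

For |u| < 1/q, factor p_u(x) = (1 - au)(1 - bu) with a + b = x, ab = q. With P_m(x) = a^m + b^m this
gives det_Γ Δ(u) = exp(-∑ Tr_Γ P_m(A) u^m/m) (`exists_hasSum_analyticDet`).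

The Euler product is compared with this series by counting. Let N_m be the number of reduced closed
paths of length m that start in F. A transfer operator on oriented edges gives the recurrences for
walks without backtracking, and removing tails gives N_m = Tr_Γ P_m(A) + |F|(q-1)(1 + (-1)^m)/2 for
m ≥ 1 (`cycleSum_eq_trace`). On the other hand ∑ N_m u^m/m is a sum over primitive paths and their
powers. Freeness of the action shows that a class of prime cycles C has |C|/|Γ_C| representatives
that start in F (`card_fiber_mul_card_stabilizer`), so the sum is the logarithm of the Euler
product. The parity term sums to χ(B) log(1 - u²). -/

noncomputable section

open MeasureTheory Filter Topology
open scoped InnerProductSpace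

namespace PeriodicGraph

/-! ### Spectral measures of self-adjoint operators -/

section Spectral

variable {H : Type*} [NormedAddCommGroup H] [InnerProductSpace ℂ H]
  {ι : Type*}

/-- The sum of the diagonal coefficients `⟪v i, T (v i)⟫` over a finite family of vectors. -/
def diagSum (s : Finset ι) (v : ι → H) : (H →L[ℂ] H) →ₗ[ℂ] ℂ where
  toFun T := ∑ i ∈ s, ⟪v i, T (v i)⟫_ℂ
  map_add' S T := by simp [Finset.sum_add_distrib]
  map_smul' c T := by simp [Finset.mul_sum]

theorem diagSum_apply (s : Finset ι) (v : ι → H) (T : H →L[ℂ] H) :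
    diagSum s v T = ∑ i ∈ s, ⟪v i, T (v i)⟫_ℂ := rfl

theorem diagSum_im_of_isSelfAdjoint [CompleteSpace H] (s : Finset ι) (v : ι → H) {T : H →L[ℂ] H}
    (hT : IsSelfAdjoint T) : (diagSum s v T).im = 0 := by
  rw [diagSum_apply, Complex.im_sum]
  exact Finset.sum_eq_zero fun i _ => hT.isSymmetric.im_inner_self_apply (v i)

theorem diagSum_re_nonneg (s : Finset ι) (v : ι → H) {T : H →L[ℂ] H} (hT : 0 ≤ T) :
    0 ≤ (diagSum s v T).re := by
  rw [diagSum_apply, Complex.re_sum]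
  refine Finset.sum_nonneg fun i _ => ?_
  exact ((ContinuousLinearMap.nonneg_iff_isPositive T).1 hT).re_inner_nonneg_right (v i)

variable [CompleteSpace H]

/-- Riesz–Markov for the functional f ↦ Re ∑ ⟪v i, f(A) v i⟫, which is positive because f ≥ 0 makes
f(A) positive. The spectrum is compact, so compact support is no restriction. Complex f are split
into real and imaginary parts. -/
theorem exists_spectralMeasure (s : Finset ι) (v : ι → H) {A : H →L[ℂ] H}
    (hA : IsSelfAdjoint A) :
    ∃ μ : Measure (spectrum ℝ A), IsFiniteMeasure μ ∧
      ∀ f : ℂ → ℂ, ContinuousOn f (spectrum ℂ A) →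
        diagSum s v (cfc f A) = ∫ x : spectrum ℝ A, f (x : ℝ) ∂μ := by
  let Λ₀ : C(spectrum ℝ A, ℝ) →ₗ[ℝ] ℝ :=
    { toFun := fun f => (diagSum s v (cfcHom hA f)).re
      map_add' := fun f g => by rw [map_add, map_add, Complex.add_re]
      map_smul' := fun c f => by
        rw [map_smul, ← Complex.coe_smul, map_smul]; simp }
  have hΛ₀ : ∀ f, 0 ≤ f → 0 ≤ Λ₀ f := fun f hf =>
    diagSum_re_nonneg s v (cfcHom_nonneg_iff hA |>.2 hf)
  let Λ : CompactlySupportedContinuousMap (spectrum ℝ A) ℝ →ₚ[ℝ] ℝ :=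
    PositiveLinearMap.mk₀
      { toFun := fun f => Λ₀ f.toContinuousMap
        map_add' := fun f g => Λ₀.map_add f.toContinuousMap g.toContinuousMap
        map_smul' := fun c f => Λ₀.map_smul c f.toContinuousMap }
      (fun f hf => hΛ₀ f.toContinuousMap hf)
  let μ := RealRMK.rieszMeasure Λ
  have hμ : IsFiniteMeasure μ := inferInstance
  have hreal : ∀ f : ℝ → ℝ, ContinuousOn f (spectrum ℝ A) →
      diagSum s v (cfc f A) = ((∫ x : spectrum ℝ A, f x ∂μ : ℝ) : ℂ) := by
    intro f hf
    let f' : C(spectrum ℝ A, ℝ) := ⟨_, hf.domRestrict⟩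
    have h := RealRMK.integral_rieszMeasure Λ (CompactlySupportedContinuousMap.continuousMapEquiv f')
    have h' : ∫ x : spectrum ℝ A, f x ∂μ = (diagSum s v (cfc f A)).re := by
      rw [cfc_apply f A hA hf]
      exact h
    rw [h']
    refine Complex.ext rfl ?_
    rw [diagSum_im_of_isSelfAdjoint s v (cfc_predicate f A)]
    simp
  refine ⟨μ, hμ, fun f hf => ?_⟩
  have hmem : ∀ x ∈ spectrum ℝ A, (x : ℂ) ∈ spectrum ℂ A := fun x hx =>
    (spectrum.algebraMap_mem_iff ℂ).2 hx
  have hfr : ContinuousOn (fun x : ℝ => f x) (spectrum ℝ A) :=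
    hf.comp Complex.continuous_ofReal.continuousOn hmem
  have hre : ∀ x ∈ spectrum ℂ A, ((x.re : ℝ) : ℂ) = x := fun x hx =>
    (hA.mem_spectrum_eq_re hx).symm
  have h1 : cfc f A = cfc (fun x : ℝ => (f x).re) A + Complex.I • cfc (fun x : ℝ => (f x).im) A := by
    have hc1 : ContinuousOn (fun x : ℂ => ((f x.re).re : ℂ)) (spectrum ℂ A) := by
      refine (Complex.continuous_ofReal.comp Complex.continuous_re).comp_continuousOn
        (hf.congr fun x hx => ?_)
      rw [hre x hx]
    have hc2 : ContinuousOn (fun x : ℂ => ((f x.re).im : ℂ)) (spectrum ℂ A) := by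
      refine (Complex.continuous_ofReal.comp Complex.continuous_im).comp_continuousOn
        (hf.congr fun x hx => ?_)
      rw [hre x hx]
    rw [cfc_real_eq_complex _ hA, cfc_real_eq_complex _ hA, ← cfc_smul Complex.I _ A hc2,
      ← cfc_add A _ (fun x => Complex.I • ((f x.re).im : ℂ)) hc1 (hc2.const_smul Complex.I)]
    refine cfc_congr fun x hx => ?_
    simp only [hre x hx, smul_eq_mul]
    rw [mul_comm, Complex.re_add_im]
  have hi : Integrable (fun x : spectrum ℝ A => f (x : ℝ)) μ := by
    have : Continuous (fun x : spectrum ℝ A => f (x : ℝ)) := hfr.domRestrict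
    exact this.integrable_of_hasCompactSupport (HasCompactSupport.of_compactSpace _)
  rw [h1, map_add, map_smul, hreal (fun x => (f x).re) (Complex.continuous_re.comp_continuousOn hfr),
    hreal (fun x => (f x).im) (Complex.continuous_im.comp_continuousOn hfr)]
  rw [← integral_re_add_im hi, smul_eq_mul, mul_comm]
  rfl

/-! ### The logarithm of a function of a self-adjoint operator -/

/-- A continuous branch is a local inverse of `exp`, hence holomorphic. Cauchy's formula needs this,
while `LogData` only records continuity. -/
theorem LogData.hasDerivAt_log {E : Type*} [NormedAddCommGroup E] [NormedSpace ℂ E]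
    {T : E →L[ℂ] E} (D : LogData T) {z : ℂ} (hz : z ∈ Metric.ball D.center D.radius) :
    HasDerivAt D.log (Complex.exp (D.log z))⁻¹ z := by
  have hnhds : Metric.closedBall D.center D.radius ∈ 𝓝 z :=
    mem_of_superset (Metric.isOpen_ball.mem_nhds hz) Metric.ball_subset_closedBall
  refine HasDerivAt.of_local_left_inverse (D.log_continuousOn.continuousAt hnhds)
    (Complex.hasDerivAt_exp _) (Complex.exp_ne_zero _) ?_
  filter_upwards [hnhds] with w hw using D.exp_log w hw

/-- The resolvent of g(A) at λ is the function (λ - g(x))⁻¹ of A. The contour integral can be moved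
inside the functional calculus, where Cauchy's formula evaluates it for each x. -/
theorem LogData.logOp_cfc {A : H →L[ℂ] H} (hA : IsSelfAdjoint A) {g : ℂ → ℂ}
    (hg : ContinuousOn g (spectrum ℂ A)) (D : LogData (cfc g A)) :
    D.logOp = cfc (fun x => D.log (g x)) A := by
  have hAn : IsStarNormal A := hA.isStarNormal
  have hball : ∀ x ∈ spectrum ℂ A, g x ∈ Metric.ball D.center D.radius := fun x hx =>
    D.conv_subset <| subset_convexHull ℝ _ <| by
      rw [cfc_map_spectrum g A hAn hg]; exact ⟨x, hx, rfl⟩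
  have hne : ∀ θ : ℝ, ∀ x ∈ spectrum ℂ A, circleMap D.center D.radius θ - g x ≠ 0 := by
    intro θ x hx h
    have h1 := hball x hx
    rw [← sub_eq_zero.1 h, Metric.mem_ball, dist_eq_norm] at h1
    simp [circleMap, abs_of_pos D.radius_pos] at h1
  have hcl : ∀ θ : ℝ, circleMap D.center D.radius θ ∈ Metric.closedBall D.center D.radius :=
    fun θ => Metric.sphere_subset_closedBall (circleMap_mem_sphere _ D.radius_pos.le _)
  have hlogc : Continuous fun θ : ℝ => D.log (circleMap D.center D.radius θ) :=
    D.log_continuousOn.comp_continuous (continuous_circleMap _ _) hcl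
  have hres : ∀ θ : ℝ, resolvent (cfc g A) (circleMap D.center D.radius θ) =
      cfc (fun x => (circleMap D.center D.radius θ - g x)⁻¹) A := by
    intro θ
    rw [cfc_inv _ A (hne θ) (continuousOn_const.sub hg) hAn, cfc_sub _ _ A continuousOn_const hg,
      cfc_const _ A hAn]
    rfl
  let f : ℝ → ℂ → ℂ := fun θ x => deriv (circleMap D.center D.radius) θ *
    (D.log (circleMap D.center D.radius θ) * (circleMap D.center D.radius θ - g x)⁻¹)
  have hf : ContinuousOn (Function.uncurry f) (Set.univ ×ˢ spectrum ℂ A) := by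
    have h1 : Continuous fun p : ℝ × ℂ => circleMap D.center D.radius p.1 :=
      (continuous_circleMap _ _).comp continuous_fst
    refine ContinuousOn.mul ?_ (ContinuousOn.mul ?_ (ContinuousOn.inv₀ ?_ ?_))
    · simp only [deriv_circleMap]
      exact (((continuous_circleMap _ _).comp continuous_fst).mul continuous_const).continuousOn
    · exact (hlogc.comp continuous_fst).continuousOn
    · exact h1.continuousOn.sub (hg.comp continuousOn_snd fun p hp => hp.2)
    · exact fun p hp => hne p.1 p.2 hp.2
  obtain ⟨C, hC⟩ := ((isCompact_Icc (a := (0 : ℝ)) (b := 2 * Real.pi)).prod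
    (spectrum.isCompact A)).exists_bound_of_continuousOn
      (hf.mono (Set.prod_mono (Set.subset_univ _) le_rfl))
  have hint := cfc_setIntegral (s := Set.Ioc 0 (2 * Real.pi)) (μ := volume) measurableSet_Ioc f
    (fun _ => C) A (hf.mono (Set.prod_mono (Set.subset_univ _) le_rfl))
    (ae_restrict_of_forall_mem measurableSet_Ioc fun θ hθ x hx =>
      hC (θ, x) ⟨Set.Ioc_subset_Icc_self hθ, hx⟩)
    (by
      have : IsFiniteMeasure (volume.restrict (Set.Ioc 0 (2 * Real.pi))) := by
        constructor; simp [ENNReal.mul_lt_top]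
      exact (integrable_const C).hasFiniteIntegral) hAn
  have hfc : ∀ θ : ℝ, cfc (f θ) A = deriv (circleMap D.center D.radius) θ •
      (D.log (circleMap D.center D.radius θ) •
        resolvent (cfc g A) (circleMap D.center D.radius θ)) := by
    intro θ
    have hc : ContinuousOn (fun x => (circleMap D.center D.radius θ - g x)⁻¹) (spectrum ℂ A) :=
      (continuousOn_const.sub hg).inv₀ (hne θ)
    rw [hres θ, ← cfc_smul _ _ A hc, ← cfc_smul _ (fun x => D.log (circleMap D.center D.radius θ) •
        (circleMap D.center D.radius θ - g x)⁻¹) A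
        (hc.const_smul (D.log (circleMap D.center D.radius θ)))]
    rfl
  have hscalar : ∀ x ∈ spectrum ℂ A, (2 * Real.pi * Complex.I : ℂ)⁻¹ *
      (∫ θ in Set.Ioc 0 (2 * Real.pi), f θ x) = D.log (g x) := by
    intro x hx
    have h1 := Complex.two_pi_I_inv_smul_circleIntegral_sub_inv_smul_of_differentiable_on_off_countable
      (f := D.log) Set.countable_empty (hball x hx) D.log_continuousOn
      (fun z hz => (D.hasDerivAt_log hz.1).differentiableAt)
    rw [← h1, circleIntegral, intervalIntegral.integral_of_le Real.two_pi_pos.le]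
    simp only [smul_eq_mul]
    congr 1
    refine integral_congr_ae (Eventually.of_forall fun θ => ?_)
    simp only [f]
    ring
  -- Continuity of the parameter integral is read off from its value given by Cauchy's formula.
  have hcont : ContinuousOn (fun x => ∫ θ in Set.Ioc 0 (2 * Real.pi), f θ x) (spectrum ℂ A) := by
    have h2 : ContinuousOn (fun x => (2 * Real.pi * Complex.I : ℂ) * D.log (g x))
        (spectrum ℂ A) :=
      continuousOn_const.mul (D.log_continuousOn.comp hg fun x hx =>
        Metric.ball_subset_closedBall (hball x hx))
    refine h2.congr fun x hx => ?_
    beta_reduce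
    rw [← hscalar x hx, mul_inv_cancel_left₀ Complex.two_pi_I_ne_zero]
  rw [LogData.logOp, circleIntegral, intervalIntegral.integral_of_le Real.two_pi_pos.le]
  simp only [← hfc]
  rw [← hint, ← cfc_smul _ _ A hcont]
  exact cfc_congr fun x hx => hscalar x hx

/-- The analytic determinant of a function of a self-adjoint operator can be computed with any
continuous logarithm along a convex set that contains the spectrum. -/
theorem analyticDet_cfc {A : H →L[ℂ] H} (hA : IsSelfAdjoint A) {τ : (H →L[ℂ] H) → ℂ}
    {μ : Measure (spectrum ℝ A)} [IsFiniteMeasure μ] {n : ℕ}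
    (hτ : ∀ f : ℂ → ℂ, ContinuousOn f (spectrum ℂ A) →
      τ (cfc f A) = ∫ x : spectrum ℝ A, f (x : ℝ) ∂μ)
    (hn : μ.real Set.univ = n) {g : ℂ → ℂ} (hg : ContinuousOn g (spectrum ℂ A))
    (hgaff : ∀ x y : ℝ, ∀ s t : ℝ, 0 ≤ s → 0 ≤ t → s + t = 1 →
      g ((s * x + t * y : ℝ) : ℂ) = s * g x + t * g y)
    (hD : Nonempty (LogData (cfc g A))) {K : Set ℝ} (hK : Convex ℝ K) (hAK : spectrum ℝ A ⊆ K)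
    {l : ℝ → ℂ} (hl : ContinuousOn l K) (hexp : ∀ x ∈ K, Complex.exp (l x) = g x) :
    analyticDet τ (cfc g A) = Complex.exp (∫ x : spectrum ℝ A, l x ∂μ) := by
  have hAn : IsStarNormal A := hA.isStarNormal
  -- `analyticDet` uses a chosen disc and branch, so the value is computed for all of them.
  have key : ∀ D : LogData (cfc g A), Complex.exp (τ D.logOp) =
      Complex.exp (∫ x : spectrum ℝ A, l x ∂μ) := by
    intro D
    have hmem : ∀ x ∈ spectrum ℝ A, (x : ℂ) ∈ spectrum ℂ A := fun x hx =>
      (spectrum.algebraMap_mem_iff ℂ).2 hx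
    have hball : ∀ x ∈ spectrum ℂ A, g x ∈ Metric.ball D.center D.radius := fun x hx =>
      D.conv_subset <| subset_convexHull ℝ _ <| by
        rw [cfc_map_spectrum g A hAn hg]; exact ⟨x, hx, rfl⟩
    have hlogc : ContinuousOn (fun x => D.log (g x)) (spectrum ℂ A) :=
      D.log_continuousOn.comp hg fun x hx => Metric.ball_subset_closedBall (hball x hx)
    rw [D.logOp_cfc hA hg, hτ _ hlogc]
    -- On J both logarithms are defined. J is convex because g is affine on the real line, hence
    -- connected even if the spectrum is not.
    set J : Set ℝ := {x | x ∈ K ∧ g x ∈ Metric.ball D.center D.radius} with hJ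
    have hgc : ContinuousOn (fun x : ℝ => g x) K := fun x hx =>
      ((Complex.continuous_exp.comp_continuousOn hl).congr fun y hy => (hexp y hy).symm) x hx
    have hJc : Convex ℝ J := by
      rintro x ⟨hx, hx'⟩ y ⟨hy, hy'⟩ s t hs ht hst
      refine ⟨hK hx hy hs ht hst, ?_⟩
      have := (convex_ball D.center D.radius) hx' hy' hs ht hst
      change g ((s * x + t * y : ℝ) : ℂ) ∈ _
      rw [hgaff x y s t hs ht hst]
      simpa using this
    have hAJ : spectrum ℝ A ⊆ J := fun x hx => ⟨hAK hx, hball _ (hmem x hx)⟩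
    -- The difference of the two logarithms in units of 2πi: continuous and integer valued, hence
    -- constant on J.
    let d : ℝ → ℂ := fun x => (D.log (g x) - l x) / (2 * Real.pi * Complex.I)
    have hdc : ContinuousOn d J := by
      refine ContinuousOn.div_const (ContinuousOn.sub ?_ (hl.mono fun x hx => hx.1)) _
      exact D.log_continuousOn.comp (hgc.mono fun x hx => hx.1)
        fun x hx => Metric.ball_subset_closedBall hx.2
    have hdint : ∀ x ∈ J, ∃ k : ℤ, d x = k := by
      intro x hx
      have h1 : Complex.exp (D.log (g x)) = Complex.exp (l x) := by
        rw [D.exp_log _ (Metric.ball_subset_closedBall hx.2), hexp x hx.1]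
      obtain ⟨k, hk⟩ := Complex.exp_eq_exp_iff_exists_int.1 h1
      refine ⟨k, ?_⟩
      simp only [d]
      rw [hk, add_sub_cancel_left, mul_div_assoc, div_self Complex.two_pi_I_ne_zero, mul_one]
    have hconst : ∃ k : ℤ, ∀ x ∈ J, d x = k := by
      rcases J.eq_empty_or_nonempty with h | ⟨x₀, hx₀⟩
      · exact ⟨0, by simp [h]⟩
      obtain ⟨k, hk⟩ := hdint x₀ hx₀
      refine ⟨k, fun x hx => ?_⟩
      have hre : ContinuousOn (fun x => (d x).re) J := Complex.continuous_re.comp_continuousOn hdc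
      have := hJc.isPreconnected.constant_of_mapsTo (T := Set.range ((↑) : ℤ → ℝ)) ?_ hre ?_ hx hx₀
      · obtain ⟨j, hj⟩ := hdint x hx
        rw [hj, hk] at this
        rw [hj]
        simpa using this
      · exact Int.isClosedEmbedding_coe_real.isEmbedding.isDiscrete_range
      · intro y hy
        obtain ⟨j, hj⟩ := hdint y hy
        exact ⟨j, by simp [hj]⟩
    obtain ⟨k, hk⟩ := hconst
    have hpt : ∀ x : spectrum ℝ A, D.log (g (x : ℝ)) = l x + k * (2 * Real.pi * Complex.I) := by
      intro x
      have := hk x (hAJ x.2)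
      simp only [d] at this
      rw [div_eq_iff Complex.two_pi_I_ne_zero] at this
      rw [← this]; ring
    simp only [hpt]
    have hli : Integrable (fun x : spectrum ℝ A => l x) μ :=
      ((hl.mono hAK).domRestrict).integrable_of_hasCompactSupport (HasCompactSupport.of_compactSpace _)
    rw [integral_add hli (integrable_const _), integral_const, hn, Complex.exp_add]
    -- Integrality of the total mass makes the constant 2πik integrate to a multiple of 2πi, which
    -- `exp` does not see.
    have : ((n : ℝ) • ((k : ℂ) * (2 * Real.pi * Complex.I))) =
        ((n * k : ℤ) : ℂ) * (2 * Real.pi * Complex.I) := by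
      push_cast
      rw [Complex.real_smul]; push_cast; ring
    rw [this, Complex.exp_int_mul_two_pi_mul_I, mul_one]
  rw [analyticDet, dif_pos hD]
  exact key _

end Spectral

/-! ### The adjacency operator -/

section Adjacency

variable {V : Type*} (G : SimpleGraph V) [G.LocallyFinite]

theorem adjOp_apply (d : ℕ) (hd : ∀ v, G.degree v ≤ d) (f : L2 V) (x : V) :
    adjOp G d hd f x = ∑ y ∈ G.neighborFinset x, f y := rfl

theorem regRep_apply {G : SimpleGraph V} (γ : G ≃g G) (f : L2 V) (x : V) :
    regRep γ f x = f (γ⁻¹ x) := rfl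

theorem norm_adjOp_le (d : ℕ) (hd : ∀ v, G.degree v ≤ d) : ‖adjOp G d hd‖ ≤ d := by
  refine ContinuousLinearMap.opNorm_le_bound _ (Nat.cast_nonneg d) fun f => ?_
  refine abs_le_of_sq_le_sq' ?_ (by positivity) |>.2
  have h1 := adj_bound G d hd f
  rw [enorm_sq_eq, ← ENNReal.ofReal_mul (sq_nonneg _)] at h1
  rw [mul_pow]
  refine (ENNReal.ofReal_le_ofReal_iff (by positivity)).1 (le_trans (le_of_eq ?_) h1)
  exact (enorm_sq_eq _).symm

theorem adjOp_single [DecidableEq V] (d : ℕ) (hd : ∀ v, G.degree v ≤ d) (x : V) :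
    adjOp G d hd (lp.single 2 x (1 : ℂ)) = ∑ y ∈ G.neighborFinset x, lp.single 2 y (1 : ℂ) := by
  refine lp.ext (funext fun z => ?_)
  rw [adjOp_apply]
  simp only [lp.coeFn_sum, Finset.sum_apply, lp.coeFn_single, Pi.single_apply,
    Finset.sum_ite_eq', Finset.sum_ite_eq]
  exact if_congr (by simp [G.adj_comm]) rfl rfl

theorem adjOp_isSelfAdjoint (d : ℕ) (hd : ∀ v, G.degree v ≤ d) :
    IsSelfAdjoint (adjOp G d hd) := by
  classical
  rw [ContinuousLinearMap.isSelfAdjoint_iff']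
  refine ContinuousLinearMap.ext fun f => lp.ext (funext fun x => ?_)
  have h : ∀ (g : L2 V) (y : V), g y = ⟪lp.single 2 y (1 : ℂ), g⟫_ℂ := fun g y => by
    rw [lp.inner_single_left]; simp
  rw [h, ContinuousLinearMap.adjoint_inner_right, adjOp_single, sum_inner, adjOp_apply]
  exact Finset.sum_congr rfl fun y _ => (h f y).symm

theorem adjOp_spectrum_subset (d : ℕ) (hd : ∀ v, G.degree v ≤ d) :
    spectrum ℝ (adjOp G d hd) ⊆ Set.Icc (-(d : ℝ)) d := by
  intro x hx
  have h := spectrum.norm_le_norm_mul_of_mem hx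
  have h1 : ‖(1 : L2 V →L[ℂ] L2 V)‖ ≤ 1 := ContinuousLinearMap.norm_id_le
  have h2 : ‖x‖ ≤ d := h.trans <| (mul_le_of_le_one_right (norm_nonneg _) h1).trans
    (norm_adjOp_le G d hd)
  exact abs_le.1 h2

theorem adjOp_mem_groupAlg (d : ℕ) (hd : ∀ v, G.degree v ≤ d) (Γ : Subgroup (G ≃g G)) :
    adjOp G d hd ∈ groupAlg Γ := by
  rw [groupAlg, Subalgebra.mem_centralizer_iff]
  rintro _ ⟨γ, -, rfl⟩
  refine ContinuousLinearMap.ext fun f => lp.ext (funext fun x => ?_)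
  change regRep γ (adjOp G d hd f) x = adjOp G d hd (regRep γ f) x
  rw [regRep_apply, adjOp_apply, adjOp_apply]
  refine Finset.sum_bij' (fun y _ => γ y) (fun y _ => γ⁻¹ y) ?_ ?_ ?_ ?_ ?_
  · intro y hy
    rw [SimpleGraph.mem_neighborFinset] at hy ⊢
    rw [← RelIso.apply_inv_self γ x]
    exact (RelIso.map_rel_iff γ).2 hy
  · intro y hy
    rw [SimpleGraph.mem_neighborFinset] at hy ⊢
    exact (RelIso.map_rel_iff γ⁻¹).2 hy
  · intro y _; exact RelIso.inv_apply_self γ y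
  · intro y _; exact RelIso.apply_inv_self γ y
  · intro y _
    rw [regRep_apply, RelIso.inv_apply_self]

open Classical in
theorem trace_eq_diagSum (F : Finset V) (T : L2 V →L[ℂ] L2 V) :
    trace F T = diagSum F (fun x => lp.single 2 x (1 : ℂ)) T := by
  rw [trace, diagSum_apply]
  refine Finset.sum_congr rfl fun x _ => ?_
  rw [lp.inner_single_left]
  simp only [RCLike.inner_apply, map_one, mul_one]

theorem trace_one (F : Finset V) : trace F (1 : L2 V →L[ℂ] L2 V) = F.card := by
  classical
  simp [trace]

theorem exists_traceMeasure (F : Finset V) {A : L2 V →L[ℂ] L2 V} (hA : IsSelfAdjoint A) :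
    ∃ μ : Measure (spectrum ℝ A), IsFiniteMeasure μ ∧ μ.real Set.univ = F.card ∧
      ∀ f : ℂ → ℂ, ContinuousOn f (spectrum ℂ A) →
        trace F (cfc f A) = ∫ x : spectrum ℝ A, f (x : ℝ) ∂μ := by
  classical
  obtain ⟨μ, hμ, h⟩ := exists_spectralMeasure F (fun x => lp.single 2 x (1 : ℂ)) hA
  refine ⟨μ, hμ, ?_, fun f hf => (trace_eq_diagSum F _).trans (h f hf)⟩
  have h1 := h (fun _ => 1) continuousOn_const
  rw [← trace_eq_diagSum, cfc_const_one ℂ A hA.isStarNormal, trace_one] at h1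
  rw [integral_const, Complex.real_smul, mul_one] at h1
  exact_mod_cast h1.symm

end Adjacency

/-! ### The symbol of the deformed Laplacian -/

/-- The function of `A` that gives `Δ(u)`. -/
def symbol (q : ℕ) (u x : ℂ) : ℂ := 1 + q * u ^ 2 - u * x

theorem continuous_symbol (q : ℕ) (u : ℂ) : Continuous (symbol q u) := by
  unfold symbol; fun_prop

theorem symbol_affine (q : ℕ) (u : ℂ) (x y s t : ℝ) (h : s + t = 1) :
    symbol q u ((s * x + t * y : ℝ) : ℂ) = s * symbol q u x + t * symbol q u y := by
  have h' : (s : ℂ) + t = 1 := by exact_mod_cast h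
  unfold symbol
  push_cast
  linear_combination (-(1 + q * u ^ 2)) * h'

theorem deformedLaplacian_eq_cfc {V : Type*} (G : SimpleGraph V) [G.LocallyFinite] (q : ℕ)
    (hG : G.IsRegularOfDegree (q + 1)) (u : ℂ) :
    deformedLaplacian G q hG u = cfc (symbol q u) (adjOp G (q + 1) fun v => (hG v).le) := by
  have hA := (adjOp_isSelfAdjoint G (q + 1) fun v => (hG v).le).isStarNormal
  unfold symbol
  rw [cfc_sub _ _ _ continuousOn_const (by fun_prop), cfc_const _ _ hA,
    cfc_const_mul_id u _ hA, Algebra.algebraMap_eq_smul_one]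
  rfl

/-- The zeros of the symbol on `[-(q+1), q+1]` force `u` out of the domain. -/
theorem symbol_ne_zero {q : ℕ} (hq : 1 ≤ q) {u : ℂ} (hu : u ∈ holomorphyDomain q) {x : ℝ}
    (hx : x ∈ Set.Icc (-((q + 1 : ℕ) : ℝ)) ((q + 1 : ℕ) : ℝ)) : symbol q u x ≠ 0 := by
  intro h
  apply hu
  have hq' : (1 : ℝ) ≤ q := by exact_mod_cast hq
  have h1 := congrArg Complex.re h
  have h2 := congrArg Complex.im h
  simp [symbol, pow_two] at h1 h2
  obtain ⟨a, b⟩ := u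
  simp only at h1 h2
  simp only [Nat.cast_add, Nat.cast_one, Set.mem_Icc] at hx
  simp only [Set.mem_union, Set.mem_ofPred_eq]
  by_cases hb : b = 0
  · right
    subst hb
    refine ⟨rfl, ?_⟩
    have ha : a * x ≤ |a| * (q + 1) := by
      calc a * x ≤ |a * x| := le_abs_self _
        _ = |a| * |x| := abs_mul _ _
        _ ≤ _ := by gcongr; exact abs_le.2 ⟨by linarith, hx.2⟩
    -- For real u = a the equation is 1 + qa² = ax ≤ |a|(q+1), which factors in this way.
    have hs : (q * |a| - 1) * (|a| - 1) ≤ 0 := by nlinarith [sq_abs a]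
    have h0 := abs_nonneg a
    constructor
    · rw [div_le_iff₀ (by positivity)]
      by_contra hc
      nlinarith
    · by_contra hc
      rw [not_le] at hc
      have : 0 < (q * |a| - 1) * (|a| - 1) := mul_pos (by nlinarith) (by linarith)
      linarith
  · left
    -- The imaginary part of the equation is b(2qa - x) = 0. With x = 2qa the real part becomes 1 =
    -- q(a² + b²), the circle.
    have hx2 : x = 2 * q * a := mul_left_cancel₀ hb (by linarith)
    rw [eq_div_iff (by positivity)]
    subst hx2
    nlinarith

theorem isOpen_holomorphyDomain (q : ℕ) : IsOpen (holomorphyDomain q) := by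
  have h1 : IsClosed {u : ℂ | u.re ^ 2 + u.im ^ 2 = 1 / (q : ℝ)} :=
    isClosed_eq (by fun_prop) continuous_const
  have h2 : IsClosed {u : ℂ | u.im = 0 ∧ 1 / (q : ℝ) ≤ |u.re| ∧ |u.re| ≤ 1} :=
    (isClosed_eq Complex.continuous_im continuous_const).inter
      ((isClosed_le continuous_const Complex.continuous_re.abs).inter
        (isClosed_le Complex.continuous_re.abs continuous_const))
  exact (h1.union h2).isOpen_compl

theorem ball_subset_holomorphyDomain {q : ℕ} (hq : 1 ≤ q) :
    Metric.ball (0 : ℂ) (1 / (q : ℝ)) ⊆ holomorphyDomain q := by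
  intro u hu
  rw [mem_ball_zero_iff] at hu
  have hq' : (1 : ℝ) ≤ q := by exact_mod_cast hq
  rintro (h | ⟨_, h, _⟩)
  -- On the circle ‖u‖ < 1/q = ‖u‖², which contradicts ‖u‖ < 1.
  · have h1 : ‖u‖ ^ 2 = 1 / q := by
      rw [← Complex.normSq_eq_norm_sq, Complex.normSq_apply, ← h]; ring
    have h2 : ‖u‖ < 1 := hu.trans_le ((div_le_one (by positivity)).2 hq')
    nlinarith [norm_nonneg u]
  · exact absurd (h.trans (Complex.abs_re_le_norm u)) (not_le.2 hu)

/-- The map u ↦ 1/(qu) preserves the circle |u|² = 1/q, and on the real axis |x| ↦ 1/(q|x|)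
exchanges the ends 1/q and 1 of the removed segments. -/
theorem one_div_mem_holomorphyDomain {q : ℕ} (hq : 1 ≤ q) {u : ℂ} (hu : u ∈ holomorphyDomain q)
    (hu0 : u ≠ 0) : 1 / ((q : ℂ) * u) ∈ holomorphyDomain q := by
  have hq' : (0 : ℝ) < q := by exact_mod_cast hq
  have hn : 0 < Complex.normSq u := Complex.normSq_pos.2 hu0
  have hqn : Complex.normSq (q : ℂ) = q ^ 2 := by rw [Complex.normSq_natCast]; ring
  intro h
  apply hu
  have hre : (1 / ((q : ℂ) * u)).re = u.re / (q * Complex.normSq u) := by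
    rw [one_div, Complex.inv_re, Complex.normSq_mul, hqn]; simp; field_simp
  have him : (1 / ((q : ℂ) * u)).im = -u.im / (q * Complex.normSq u) := by
    rw [one_div, Complex.inv_im, Complex.normSq_mul, hqn]; simp; field_simp
  rcases h with h | ⟨h1, h2, h3⟩
  · left
    have h' : Complex.normSq (1 / ((q : ℂ) * u)) = 1 / q := by
      rw [Complex.normSq_apply]; rw [← h]; ring
    rw [one_div, map_inv₀, Complex.normSq_mul, hqn] at h'
    have : Complex.normSq u = 1 / q := by field_simp at h' ⊢; linarith
    simp only [Set.mem_ofPred_eq]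
    rw [← this, Complex.normSq_apply]; ring
  · right
    have h0 : u.im = 0 := by
      rw [him, div_eq_zero_iff] at h1
      rcases h1 with h1 | h1
      · linarith
      · exact absurd h1 (by positivity)
    have hns : Complex.normSq u = |u.re| ^ 2 := by
      rw [Complex.normSq_apply, h0, sq_abs]; ring
    have hpos : 0 < |u.re| := by
      rw [hns] at hn; exact (abs_nonneg _).lt_of_ne' (sq_pos_iff.1 hn)
    have habs : |(1 / ((q : ℂ) * u)).re| = 1 / (q * |u.re|) := by
      rw [hre, abs_div, hns, abs_of_pos (by positivity : 0 < (q : ℝ) * |u.re| ^ 2)]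
      field_simp
    rw [habs] at h2 h3
    refine ⟨h0, ?_, ?_⟩
    · rw [div_le_iff₀ (by positivity)] at h3 ⊢; linarith
    · rw [div_le_div_iff₀ (by positivity) (by positivity)] at h2
      nlinarith

section LogSymbol

/-! ### Logarithms along the symbol -/

/-- The interval that contains the spectrum of the adjacency operator. -/
def degreeInterval (q : ℕ) : Set ℝ := Set.Icc (-((q + 1 : ℕ) : ℝ)) ((q + 1 : ℕ) : ℝ)

theorem convex_symbol_image (q : ℕ) (u : ℂ) :
    Convex ℝ ((fun x : ℝ => symbol q u x) '' degreeInterval q) := by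
  rintro _ ⟨x, hx, rfl⟩ _ ⟨y, hy, rfl⟩ s t hs ht hst
  refine ⟨s * x + t * y, (convex_Icc _ _) hx hy hs ht hst, ?_⟩
  simp only [symbol_affine q u x y s t hst, Complex.real_smul]

theorem continuous_symbol_ofReal (q : ℕ) (u : ℂ) : Continuous fun x : ℝ => symbol q u x :=
  (continuous_symbol q u).comp Complex.continuous_ofReal

theorem isCompact_symbol_image (q : ℕ) (u : ℂ) :
    IsCompact ((fun x : ℝ => symbol q u x) '' degreeInterval q) :=
  isCompact_Icc.image (continuous_symbol_ofReal q u)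

theorem zero_mem_degreeInterval (q : ℕ) : (0 : ℝ) ∈ degreeInterval q := by
  constructor <;> [rw [Left.neg_nonpos_iff]; skip] <;> positivity

/-- The segment p_u(I) is compact, convex and misses 0, so Hahn–Banach separates it from 0; a
complex linear functional on ℂ is multiplication by some c. After this rotation the principal
logarithm applies, and log(cz) - log c is a logarithm on the segment. The uniform gap δ leaves room
for a disc around the segment and for moving u. -/
theorem exists_symbol_halfPlane {q : ℕ} (hq : 1 ≤ q) {u : ℂ} (hu : u ∈ holomorphyDomain q) :
    ∃ c : ℂ, ∃ δ : ℝ, c ≠ 0 ∧ 0 < δ ∧ ∀ x ∈ degreeInterval q, δ < (c * symbol q u x).re := by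
  obtain ⟨f, v, w, hv, hvw, hw⟩ := RCLike.geometric_hahn_banach_compact_closed (𝕜 := ℂ)
    (convex_singleton (𝕜 := ℝ) (0 : ℂ)) isCompact_singleton (convex_symbol_image q u)
    (isCompact_symbol_image q u).isClosed (by
      rw [Set.disjoint_singleton_left]
      rintro ⟨x, hx, h⟩
      exact symbol_ne_zero hq hu hx h)
  have hv0 : 0 < v := by simpa using hv 0 rfl
  have hf : ∀ x ∈ degreeInterval q, w < (f 1 * symbol q u x).re := by
    intro x hx
    have h := hw _ ⟨x, hx, rfl⟩
    have h1 : f (symbol q u x) = f 1 * symbol q u x := by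
      rw [mul_comm, ← smul_eq_mul, ← map_smul, smul_eq_mul, mul_one]
    rw [← h1]
    exact h
  refine ⟨f 1, w, fun h0 => ?_, hv0.trans hvw, hf⟩
  have := hf 0 (zero_mem_degreeInterval q)
  rw [h0, zero_mul, Complex.zero_re] at this
  linarith

/-! ### The determinant of the deformed Laplacian as an exponential of an integral -/

variable {V : Type*} (G : SimpleGraph V) [G.LocallyFinite]

theorem convexHull_spectrum_deformedLaplacian_subset {q : ℕ} (hG : G.IsRegularOfDegree (q + 1))
    (u : ℂ) : convexHull ℝ (spectrum ℂ (deformedLaplacian G q hG u)) ⊆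
      (fun x : ℝ => symbol q u x) '' degreeInterval q := by
  have hA := adjOp_isSelfAdjoint G (q + 1) fun v => (hG v).le
  refine convexHull_min ?_ (convex_symbol_image q u)
  rw [deformedLaplacian_eq_cfc,
    cfc_map_spectrum (symbol q u) _ hA.isStarNormal (continuous_symbol q u).continuousOn]
  rintro _ ⟨z, hz, rfl⟩
  have hre := hA.mem_spectrum_eq_re hz
  refine ⟨z.re, adjOp_spectrum_subset G (q + 1) (fun v => (hG v).le) ?_, ?_⟩
  · rw [hre] at hz
    exact (spectrum.algebraMap_mem_iff ℂ).1 hz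
  · simp only [← hre]

theorem zero_notMem_convexHull_spectrum {q : ℕ} (hq : 1 ≤ q) (hG : G.IsRegularOfDegree (q + 1))
    {u : ℂ} (hu : u ∈ holomorphyDomain q) :
    (0 : ℂ) ∉ convexHull ℝ (spectrum ℂ (deformedLaplacian G q hG u)) := by
  intro h
  obtain ⟨x, hx, h0⟩ := convexHull_spectrum_deformedLaplacian_subset G hG u h
  exact symbol_ne_zero hq hu hx h0

theorem nonempty_logData {q : ℕ} (hq : 1 ≤ q) (hG : G.IsRegularOfDegree (q + 1))
    {u : ℂ} (hu : u ∈ holomorphyDomain q) :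
    Nonempty (LogData (deformedLaplacian G q hG u)) := by
  obtain ⟨c, δ, hc, hδ, h⟩ := exists_symbol_halfPlane hq hu
  obtain ⟨M, hM⟩ := (isCompact_symbol_image q u).exists_bound_of_continuousOn
    (f := fun z => c * z) (by fun_prop)
  have hM' : ∀ x ∈ degreeInterval q, ‖c * symbol q u x‖ ≤ M := fun x hx => hM _ ⟨x, hx, rfl⟩
  -- Points with Re z ≥ δ and |z| ≤ M satisfy |z - t|² ≤ t² - 2tδ + M², which is below (t - δ/2)² as
  -- soon as M² < tδ. The closed disc with centre t and radius t - δ/2 stays in Re z ≥ δ/2. Division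
  -- by c undoes the rotation.
  set t : ℝ := δ + M ^ 2 / δ with ht
  have htδ : δ ≤ t := le_add_of_nonneg_right (by positivity)
  have htM : M ^ 2 < t * δ := by
    rw [ht, add_mul, div_mul_cancel₀ _ hδ.ne']
    exact lt_add_of_pos_left _ (by positivity)
  have hc' : 0 < ‖c‖ := norm_pos_iff.2 hc
  have hslit : ∀ z ∈ Metric.closedBall ((t : ℂ) / c) ((t - δ / 2) / ‖c‖),
      c * z ∈ Complex.slitPlane := by
    intro z hz
    rw [Metric.mem_closedBall, dist_eq_norm, le_div_iff₀ hc', mul_comm, ← norm_mul, mul_sub,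
      mul_div_cancel₀ _ hc] at hz
    left
    have h1 := (abs_le.1 ((Complex.abs_re_le_norm _).trans hz)).1
    rw [Complex.sub_re, Complex.ofReal_re] at h1
    linarith
  refine ⟨⟨(t : ℂ) / c, (t - δ / 2) / ‖c‖, div_pos (by linarith) hc', ?_,
    fun z => Complex.log (c * z) - Complex.log c, ?_, ?_⟩⟩
  · refine (convexHull_spectrum_deformedLaplacian_subset G hG u).trans ?_
    rintro _ ⟨x, hx, rfl⟩
    rw [Metric.mem_ball, dist_eq_norm, lt_div_iff₀ hc', mul_comm, ← norm_mul, mul_sub,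
      mul_div_cancel₀ _ hc]
    refine lt_of_pow_lt_pow_left₀ 2 (by linarith) ?_
    have h1 := h x hx
    have h2 := hM' x hx
    have h3 : ‖c * symbol q u x‖ ^ 2 ≤ M ^ 2 := by gcongr
    rw [← Complex.normSq_eq_norm_sq, Complex.normSq_apply] at h3 ⊢
    simp only [Complex.sub_re, Complex.sub_im, Complex.ofReal_re, Complex.ofReal_im, sub_zero]
    have h4 : t * δ ≤ t * (c * symbol q u x).re := by gcongr
    nlinarith
  · exact (ContinuousOn.clog (by fun_prop) hslit).sub continuousOn_const
  · intro z hz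
    have hz' := Complex.slitPlane_ne_zero (hslit z hz)
    rw [Complex.exp_sub, Complex.exp_log hz', Complex.exp_log hc, mul_div_cancel_left₀ _ hc]

theorem compactSpace_spectrum_adjOp (d : ℕ) (hd : ∀ v, G.degree v ≤ d) :
    CompactSpace (spectrum ℝ (adjOp G d hd)) :=
  isCompact_iff_compactSpace.1 (spectrum.isCompact _)

/-- The point is that one measure serves all u, so determinants at different u can be compared
through their logarithms on the fixed interval. -/
theorem exists_analyticDet_formula {q : ℕ} (hq : 1 ≤ q) (hG : G.IsRegularOfDegree (q + 1))
    (F : Finset V) :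
    ∃ μ : Measure (spectrum ℝ (adjOp G (q + 1) fun v => (hG v).le)), IsFiniteMeasure μ ∧
      μ.real Set.univ = F.card ∧
      (∀ f : ℂ → ℂ, ContinuousOn f (spectrum ℂ (adjOp G (q + 1) fun v => (hG v).le)) →
        trace F (cfc f (adjOp G (q + 1) fun v => (hG v).le)) =
          ∫ x : spectrum ℝ (adjOp G (q + 1) fun v => (hG v).le), f (x : ℝ) ∂μ) ∧
      ∀ u ∈ holomorphyDomain q, ∀ l : ℝ → ℂ, ContinuousOn l (degreeInterval q) →
        (∀ x ∈ degreeInterval q, Complex.exp (l x) = symbol q u x) →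
        analyticDet (trace F) (deformedLaplacian G q hG u) = Complex.exp (∫ x, l x ∂μ) := by
  have hA := adjOp_isSelfAdjoint G (q + 1) fun v => (hG v).le
  obtain ⟨μ, hμ, hn, h⟩ := exists_traceMeasure F hA
  refine ⟨μ, hμ, hn, h, fun u hu l hl hexp => ?_⟩
  have hD := nonempty_logData G hq hG hu
  rw [deformedLaplacian_eq_cfc] at hD ⊢
  refine @analyticDet_cfc (L2 V) _ _ _ _ hA (trace F) μ hμ _ h hn _ (continuous_symbol q u).continuousOn
    (fun x y s t _ _ hst => symbol_affine q u x y s t hst) hD _ (convex_Icc _ _)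
    (adjOp_spectrum_subset G (q + 1) fun v => (hG v).le) _ hl hexp

theorem exists_log_symbol {q : ℕ} (hq : 1 ≤ q) {u : ℂ} (hu : u ∈ holomorphyDomain q) :
    ∃ l : ℝ → ℂ, ContinuousOn l (degreeInterval q) ∧
      ∀ x ∈ degreeInterval q, Complex.exp (l x) = symbol q u x := by
  obtain ⟨c, δ, hc, hδ, h⟩ := exists_symbol_halfPlane hq hu
  have hslit : ∀ x ∈ degreeInterval q, c * symbol q u x ∈ Complex.slitPlane := fun x hx =>
    Or.inl (hδ.trans (h x hx))
  refine ⟨fun x => Complex.log (c * symbol q u x) - Complex.log c, ?_, fun x hx => ?_⟩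
  · exact (ContinuousOn.clog (continuous_const.mul
      (continuous_symbol_ofReal q u)).continuousOn hslit).sub continuousOn_const
  · rw [Complex.exp_sub, Complex.exp_log (Complex.slitPlane_ne_zero (hslit x hx)),
      Complex.exp_log hc, mul_div_cancel_left₀ _ hc]

theorem analyticDet_deformedLaplacian_ne_zero {q : ℕ} (hq : 1 ≤ q)
    (hG : G.IsRegularOfDegree (q + 1)) (F : Finset V) {u : ℂ} (hu : u ∈ holomorphyDomain q) :
    analyticDet (trace F) (deformedLaplacian G q hG u) ≠ 0 := by
  rw [analyticDet, dif_pos (nonempty_logData G hq hG hu)]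
  exact Complex.exp_ne_zero _

/-- Replacing u by 1/(qu) divides the symbol by qu², so a logarithm changes by the constant
log(qu²), which is integrated against a measure of mass |F|. -/
theorem analyticDet_functional_equation {q : ℕ} (hq : 1 ≤ q)
    (hG : G.IsRegularOfDegree (q + 1)) (F : Finset V) {u : ℂ} (hu : u ∈ holomorphyDomain q)
    (hu0 : u ≠ 0) :
    analyticDet (trace F) (deformedLaplacian G q hG (1 / ((q : ℂ) * u))) =
      ((q : ℂ) * u ^ 2) ^ (-(F.card : ℤ)) *
        analyticDet (trace F) (deformedLaplacian G q hG u) := by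
  have hq0 : (q : ℂ) ≠ 0 := by exact_mod_cast (by omega : q ≠ 0)
  obtain ⟨μ, hμ, hn, -, hdet⟩ := exists_analyticDet_formula G hq hG F
  obtain ⟨l, hl, hexp⟩ := exists_log_symbol hq hu
  have := compactSpace_spectrum_adjOp G (q + 1) fun v => (hG v).le
  have hw : (q : ℂ) * u ^ 2 ≠ 0 := mul_ne_zero hq0 (pow_ne_zero _ hu0)
  rw [hdet u hu l hl hexp, hdet _ (one_div_mem_holomorphyDomain hq hu hu0)
    (fun x => l x - Complex.log (q * u ^ 2)) (hl.sub continuousOn_const)]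
  · have hli : Integrable (fun x : spectrum ℝ (adjOp G (q + 1) fun v => (hG v).le) => l x) μ :=
      ((hl.mono (adjOp_spectrum_subset G (q + 1) _)).domRestrict).integrable_of_hasCompactSupport
        (HasCompactSupport.of_compactSpace _)
    rw [integral_sub hli (integrable_const _), integral_const, hn, Complex.exp_sub, zpow_neg,
      zpow_natCast, Complex.real_smul, Complex.ofReal_natCast, Complex.exp_nat_mul,
      Complex.exp_log hw, div_eq_inv_mul]
  · intro x hx
    rw [Complex.exp_sub, Complex.exp_log hw, hexp x hx]
    unfold symbol
    field_simp
    ring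

/-- Near u₀ the same rotation c keeps the whole segment in a half-plane, so log(c p_u(x)) - log c is
a logarithm that is holomorphic in u and can be differentiated under the integral. -/
theorem differentiableAt_analyticDet {q : ℕ} (hq : 1 ≤ q)
    (hG : G.IsRegularOfDegree (q + 1)) (F : Finset V) {u₀ : ℂ} (hu₀ : u₀ ∈ holomorphyDomain q) :
    DifferentiableAt ℂ (fun u => analyticDet (trace F) (deformedLaplacian G q hG u)) u₀ := by
  obtain ⟨μ, hμ, hn, -, hdet⟩ := exists_analyticDet_formula G hq hG F
  have hsub := adjOp_spectrum_subset G (q + 1) fun v => (hG v).le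
  have := compactSpace_spectrum_adjOp G (q + 1) fun v => (hG v).le
  obtain ⟨c, δ, hc, hδ, h⟩ := exists_symbol_halfPlane hq hu₀
  -- A bound for |c p_u(x) - c p_{u₀}(x)| that is uniform for |x| ≤ q + 1.
  let b : ℂ → ℝ := fun u => ‖c‖ * (q * ‖u ^ 2 - u₀ ^ 2‖ + ‖u - u₀‖ * (q + 1))
  have hb : Continuous b := by fun_prop
  have hb0 : b u₀ = 0 := by simp [b]
  have hnear : ∀ u, b u < δ / 2 → ∀ x ∈ degreeInterval q,
      δ / 2 < (c * symbol q u x).re := by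
    intro u hu x hx
    have h1 : ‖c * symbol q u x - c * symbol q u₀ x‖ ≤ b u := by
      have : c * symbol q u x - c * symbol q u₀ x =
          c * (q * (u ^ 2 - u₀ ^ 2) - (u - u₀) * x) := by unfold symbol; ring
      rw [this, norm_mul]
      have hx' : ‖(x : ℂ)‖ ≤ q + 1 := by
        rw [Complex.norm_real]
        have := abs_le.2 hx
        push_cast at this
        exact this
      refine mul_le_mul_of_nonneg_left ((norm_sub_le _ _).trans ?_) (norm_nonneg c)
      rw [norm_mul, norm_mul, Complex.norm_natCast]
      gcongr
    have h2 := (abs_le.1 ((Complex.abs_re_le_norm _).trans h1)).1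
    rw [Complex.sub_re] at h2
    linarith [h x hx]
  let s : Set ℂ := {u | b u < δ / 2} ∩ holomorphyDomain q ∩ Metric.ball u₀ 1
  have hs : s ∈ 𝓝 u₀ := by
    refine inter_mem (inter_mem ?_ ((isOpen_holomorphyDomain q).mem_nhds hu₀))
      (Metric.ball_mem_nhds _ one_pos)
    exact (isOpen_lt hb continuous_const).mem_nhds (by
      change b u₀ < δ / 2
      rw [hb0]; positivity)
  let l : ℂ → ℝ → ℂ := fun u x => Complex.log (c * symbol q u x) - Complex.log c
  have hslit : ∀ u ∈ s, ∀ x ∈ degreeInterval q, c * symbol q u x ∈ Complex.slitPlane :=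
    fun u hu x hx => Or.inl ((half_pos hδ).trans (hnear u hu.1.1 x hx))
  have hlc : ∀ u ∈ s, ContinuousOn (l u) (degreeInterval q) := fun u hu =>
    (ContinuousOn.clog (continuous_const.mul (continuous_symbol_ofReal q u)).continuousOn
      (hslit u hu)).sub continuousOn_const
  have hldet : ∀ u ∈ s, analyticDet (trace F) (deformedLaplacian G q hG u) =
      Complex.exp (∫ x, l u x ∂μ) := fun u hu => by
    refine hdet u hu.1.2 (l u) (hlc u hu) fun x hx => ?_
    simp only [l]
    rw [Complex.exp_sub, Complex.exp_log (Complex.slitPlane_ne_zero (hslit u hu x hx)),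
      Complex.exp_log hc, mul_div_cancel_left₀ _ hc]
  let l' : ℂ → ℝ → ℂ := fun u x => c * (2 * q * u - x) / (c * symbol q u x)
  have hli : ∀ u ∈ s, Continuous
      (fun x : spectrum ℝ (adjOp G (q + 1) fun v => (hG v).le) => l u x) := fun u hu =>
    ((hlc u hu).mono hsub).domRestrict
  have hu₀s : u₀ ∈ s := mem_of_mem_nhds hs
  have hder := hasDerivAt_integral_of_dominated_loc_of_deriv_le (μ := μ) (𝕜 := ℂ) (s := s)
    (x₀ := u₀) (F := fun u x => l u x) (F' := fun u x => l' u x)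
    -- Numerator: |u| ≤ ‖u₀‖ + 1 and |x| ≤ q + 1. Denominator: the real part of c p_u(x) exceeds
    -- δ/2.
    (bound := fun _ => ‖c‖ * (2 * q * (‖u₀‖ + 1) + (q + 1)) / (δ / 2)) hs
    (mem_of_superset hs fun u hu => (hli u hu).aestronglyMeasurable)
    ((hli u₀ hu₀s).integrable_of_hasCompactSupport (HasCompactSupport.of_compactSpace _))
    (by
      refine Continuous.aestronglyMeasurable ?_
      have hc1 : ContinuousOn (l' u₀) (degreeInterval q) := by
        refine ContinuousOn.div (by fun_prop)
          (continuous_const.mul (continuous_symbol_ofReal q u₀)).continuousOn fun x hx => ?_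
        exact Complex.slitPlane_ne_zero (hslit u₀ hu₀s x hx)
      exact (hc1.mono hsub).domRestrict)
    (Eventually.of_forall fun x u hu => by
      have hx := hsub x.2
      have hx' : ‖((x : ℝ) : ℂ)‖ ≤ q + 1 := by
        rw [Complex.norm_real]
        have := abs_le.2 hx
        push_cast at this
        exact this
      have hun : ‖u‖ ≤ ‖u₀‖ + 1 := by
        have h1 := hu.2
        rw [Metric.mem_ball, dist_eq_norm] at h1
        have := norm_sub_norm_le u u₀
        linarith
      have hden : δ / 2 ≤ ‖c * symbol q u (x : ℝ)‖ :=
        (hnear u hu.1.1 x hx).le.trans (Complex.re_le_norm _)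
      simp only [l']
      rw [norm_div, norm_mul]
      refine div_le_div₀ (by positivity) ?_ (by positivity) hden
      refine mul_le_mul_of_nonneg_left ((norm_sub_le _ _).trans ?_) (norm_nonneg c)
      rw [norm_mul, norm_mul, Complex.norm_natCast, Complex.norm_ofNat]
      gcongr)
    (integrable_const _)
    (Eventually.of_forall fun x u hu => by
      have hx := hsub x.2
      have h1 : HasDerivAt (fun u => c * symbol q u (x : ℝ)) (c * (2 * q * u - (x : ℝ))) u := by
        have h2 : HasDerivAt (fun u : ℂ => symbol q u (x : ℝ)) (2 * q * u - (x : ℝ)) u := by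
          unfold symbol
          have h3 := (((hasDerivAt_pow 2 u).const_mul (q : ℂ)).const_add 1).sub
            ((hasDerivAt_id u).mul_const ((x : ℝ) : ℂ))
          convert! h3 using 1
          simp; ring
        exact h2.const_mul c
      exact (h1.clog (hslit u hu x hx)).sub_const _)
  have hD := hder.2.cexp.differentiableAt
  refine hD.congr_of_eventuallyEq ?_
  exact mem_of_superset hs fun u hu => hldet u hu

theorem differentiableOn_zeta_extension {q : ℕ} (hq : 1 ≤ q)
    (hG : G.IsRegularOfDegree (q + 1)) (F : Finset V) (χ : ℤ) :
    DifferentiableOn ℂ (fun u => (1 - u ^ 2) ^ χ *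
      (analyticDet (trace F) (deformedLaplacian G q hG u))⁻¹) (holomorphyDomain q) := by
  intro u hu
  refine DifferentiableAt.differentiableWithinAt (DifferentiableAt.mul ?_
    ((differentiableAt_analyticDet G hq hG F hu).inv
      (analyticDet_deformedLaplacian_ne_zero G hq hG F hu)))
  -- The exponent may be negative; the points ±1 are ends of the removed segments because 1/q ≤ 1.
  have hu1 : 1 - u ^ 2 ≠ 0 := by
    intro h0
    have hq' : (1 : ℝ) ≤ q := by exact_mod_cast hq
    apply hu
    right
    have h1 : (1 - u) * (1 + u) = 0 := by rw [← h0]; ring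
    rcases mul_eq_zero.1 h1 with h | h
    · rw [← sub_eq_zero.1 h]
      simpa using inv_le_one_of_one_le₀ hq'
    · rw [eq_neg_of_add_eq_zero_right h]
      simpa using inv_le_one_of_one_le₀ hq'
  exact DifferentiableAt.zpow (by fun_prop) (Or.inl hu1)

end LogSymbol

section PowerSums

/-! ### Power sums of the roots of the symbol -/

/-- The power sums `α ^ m + β ^ m`, where `α + β = x` and `α β = q`. -/
def powerSum {R : Type*} [Ring R] (q : ℕ) (x : R) : ℕ → R
  | 0 => 2
  | 1 => x
  | m + 2 => x * powerSum q x (m + 1) - q * powerSum q x m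

theorem powerSum_eq {R : Type*} [CommRing R] {q : ℕ} {a b : R} (h : a * b = q) (m : ℕ) :
    powerSum q (a + b) m = a ^ m + b ^ m := by
  induction m using Nat.twoStepInduction with
  | zero => simp [powerSum]; norm_num
  | one => simp [powerSum]
  | more m h1 h2 => rw [powerSum, h1, h2, ← h]; ring

theorem continuous_powerSum (q m : ℕ) : Continuous fun x : ℂ => powerSum q x m := by
  induction m using Nat.twoStepInduction with
  | zero => simp only [powerSum]; fun_prop
  | one => simp only [powerSum]; fun_prop
  | more m h1 h2 => simp only [powerSum]; fun_prop

/-- The roots of t² - xt + q. A non-real root has |t|² = q ≤ q², and a real one satisfies t² + q ≤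
(q+1)|t|, that is (|t| - q)(|t| - 1) ≤ 0. -/
theorem exists_roots {q : ℕ} (hq : 1 ≤ q) {x : ℝ} (hx : x ∈ degreeInterval q) :
    ∃ a b : ℂ, a + b = x ∧ a * b = q ∧ ‖a‖ ≤ q ∧ ‖b‖ ≤ q := by
  have root_norm : ∀ a : ℂ, a ^ 2 + q = x * a → ‖a‖ ≤ q := by
    intro a h
    have hq' : (1 : ℝ) ≤ q := by exact_mod_cast hq
    have h1 := congrArg Complex.re h
    have h2 := congrArg Complex.im h
    obtain ⟨s, t⟩ := a
    simp [pow_two] at h1 h2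
    have hx' : |x| ≤ q + 1 := by
      have := abs_le.2 hx
      push_cast at this
      exact this
    refine le_of_sq_le_sq ?_ (by positivity)
    rw [← Complex.normSq_eq_norm_sq, Complex.normSq_mk]
    by_cases ht : t = 0
    · subst ht
      have h3 : s * s + q ≤ (q + 1) * |s| := by
        calc s * s + q = x * s := by linarith
          _ ≤ |x * s| := le_abs_self _
          _ = |x| * |s| := abs_mul _ _
          _ ≤ _ := by gcongr
      have h5 : |s| ≤ q := by
        by_contra hc
        rw [not_le] at hc
        have : 0 < (|s| - q) * (|s| - 1) := mul_pos (by linarith) (by linarith)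
        nlinarith [sq_abs s]
      nlinarith [sq_abs s, abs_nonneg s]
    · have h4 : x = 2 * s := mul_right_cancel₀ ht (by linarith)
      subst h4
      nlinarith
  obtain ⟨a, ha⟩ := IsAlgClosed.exists_pow_nat_eq ((x : ℂ) ^ 2 - 4 * q) (n := 2) two_pos
  have h1 : (((x : ℂ) + a) / 2) ^ 2 + q = x * ((x + a) / 2) := by linear_combination (1 / 4) * ha
  have h2 : (((x : ℂ) - a) / 2) ^ 2 + q = x * ((x - a) / 2) := by linear_combination (1 / 4) * ha
  exact ⟨(x + a) / 2, (x - a) / 2, by ring, by linear_combination (-1 / 4) * ha,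
    root_norm _ h1, root_norm _ h2⟩

theorem norm_mul_lt_one {q : ℕ} (hq : 1 ≤ q) {u a : ℂ} (hu : ‖u‖ < 1 / (q : ℝ)) (ha : ‖a‖ ≤ q) :
    ‖a * u‖ < 1 := by
  have hq' : (0 : ℝ) < q := by exact_mod_cast hq
  rw [norm_mul]
  rw [lt_div_iff₀ hq'] at hu
  nlinarith [norm_nonneg u]

theorem norm_powerSum_term_le {q : ℕ} (hq : 1 ≤ q) (u : ℂ) {x : ℝ} (hx : x ∈ degreeInterval q)
    (m : ℕ) : ‖powerSum q (x : ℂ) m * u ^ m / m‖ ≤ 2 * (q * ‖u‖) ^ m := by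
  obtain ⟨a, b, hab, hmul, ha, hb⟩ := exists_roots hq hx
  rw [← hab, powerSum_eq hmul, norm_div, norm_mul, norm_pow, mul_pow, Complex.norm_natCast]
  have h1 : ‖a ^ m + b ^ m‖ ≤ 2 * (q : ℝ) ^ m := by
    refine (norm_add_le _ _).trans ?_
    rw [norm_pow, norm_pow, two_mul]
    gcongr
  -- At m = 0 the division by zero makes the term 0.
  rcases m.eq_zero_or_pos with rfl | hm
  · simp
  refine (div_le_self (by positivity) (by exact_mod_cast hm)).trans ?_
  rw [← mul_assoc]
  gcongr

/-- The symbol factors as (1 - au)(1 - bu), and both logarithm series converge because |a|, |b| ≤ q.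
-/
theorem exp_tsum_powerSum {q : ℕ} (hq : 1 ≤ q) {u : ℂ} (hu : ‖u‖ < 1 / (q : ℝ)) {x : ℝ}
    (hx : x ∈ degreeInterval q) :
    Complex.exp (-∑' m : ℕ, powerSum q (x : ℂ) m * u ^ m / m) = symbol q u x := by
  obtain ⟨a, b, hab, hmul, ha, hb⟩ := exists_roots hq hx
  have h1 := norm_mul_lt_one hq hu ha
  have h2 := norm_mul_lt_one hq hu hb
  have hs := (Complex.hasSum_taylorSeries_neg_log h1).add (Complex.hasSum_taylorSeries_neg_log h2)
  have hs' : HasSum (fun m : ℕ => powerSum q (x : ℂ) m * u ^ m / m)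
      (-Complex.log (1 - a * u) + -Complex.log (1 - b * u)) := by
    convert! hs using 2 with m
    rw [← hab, powerSum_eq hmul]
    ring
  have hne : ∀ z : ℂ, ‖z‖ < 1 → 1 - z ≠ 0 := fun z hz h => by
    rw [← sub_eq_zero.1 h] at hz
    simp at hz
  rw [hs'.tsum_eq, neg_add, neg_neg, neg_neg, Complex.exp_add, Complex.exp_log (hne _ h1),
    Complex.exp_log (hne _ h2)]
  unfold symbol
  linear_combination (-u) * hab + u ^ 2 * hmul

/-! ### The determinant as an exponential of a power series in u -/

variable {V : Type*} (G : SimpleGraph V) [G.LocallyFinite]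

theorem cfc_powerSum {H : Type*} [NormedAddCommGroup H] [InnerProductSpace ℂ H] [CompleteSpace H]
    {A : H →L[ℂ] H} (hA : IsStarNormal A) (q m : ℕ) :
    cfc (fun x : ℂ => powerSum q x m) A = powerSum q A m := by
  induction m using Nat.twoStepInduction with
  | zero =>
    change cfc (fun _ : ℂ => 2) A = 2
    rw [cfc_const _ A hA, map_ofNat]
  | one => exact cfc_id' ℂ A hA
  | more m h1 h2 =>
    have c1 := (continuous_powerSum q (m + 1)).continuousOn (s := spectrum ℂ A)
    have c2 := (continuous_powerSum q m).continuousOn (s := spectrum ℂ A)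
    have c3 : ContinuousOn (fun x : ℂ => x * powerSum q x (m + 1)) (spectrum ℂ A) :=
      continuousOn_id.mul c1
    have c4 : ContinuousOn (fun x : ℂ => (q : ℂ) * powerSum q x m) (spectrum ℂ A) :=
      continuousOn_const.mul c2
    change cfc (fun x : ℂ => x * powerSum q x (m + 1) - q * powerSum q x m) A =
      A * powerSum q A (m + 1) - q * powerSum q A m
    rw [cfc_sub _ _ A c3 c4, cfc_mul (fun x => x) _ A continuousOn_id c1,
      cfc_mul _ _ A continuousOn_const c2, h1, h2, cfc_id' ℂ A hA, cfc_const _ A hA, map_natCast]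

/-- The geometric bound 2(q|u|)^m serves twice: it makes the logarithm series continuous on the
interval, so that it may be inserted in the integral formula, and it allows integration term by
term. -/
theorem exists_hasSum_analyticDet {q : ℕ} (hq : 1 ≤ q) (hG : G.IsRegularOfDegree (q + 1))
    (F : Finset V) {u : ℂ} (hu : ‖u‖ < 1 / (q : ℝ)) :
    ∃ W : ℂ, HasSum (fun m : ℕ => trace F (powerSum q (adjOp G (q + 1) fun v => (hG v).le) m) *
        u ^ m / m) W ∧
      analyticDet (trace F) (deformedLaplacian G q hG u) = Complex.exp (-W) := by
  have hq' : (0 : ℝ) < q := by exact_mod_cast hq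
  obtain ⟨μ, hμ, hn, htr, hdet⟩ := exists_analyticDet_formula G hq hG F
  have hsub := adjOp_spectrum_subset G (q + 1) fun v => (hG v).le
  have := compactSpace_spectrum_adjOp G (q + 1) fun v => (hG v).le
  have hA := (adjOp_isSelfAdjoint G (q + 1) fun v => (hG v).le).isStarNormal
  have hqu : q * ‖u‖ < 1 := by rw [lt_div_iff₀ hq'] at hu; linarith
  have hgeom : Summable fun m : ℕ => 2 * (q * ‖u‖) ^ m :=
    (summable_geometric_of_lt_one (by positivity) hqu).mul_left 2
  let t : ℕ → ℝ → ℂ := fun m x => powerSum q (x : ℂ) m * u ^ m / m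
  have htc : ∀ m, Continuous (t m) := fun m =>
    (((continuous_powerSum q m).comp Complex.continuous_ofReal).mul continuous_const).div_const _
  have hti : ∀ m, Integrable
      (fun x : spectrum ℝ (adjOp G (q + 1) fun v => (hG v).le) => t m x) μ := fun m =>
    ((htc m).comp continuous_subtype_val).integrable_of_hasCompactSupport
      (HasCompactSupport.of_compactSpace _)
  have hbd : ∀ m, ∫ x : spectrum ℝ (adjOp G (q + 1) fun v => (hG v).le), ‖t m x‖ ∂μ ≤
      F.card * (2 * (q * ‖u‖) ^ m) := by
    intro m
    refine (integral_mono (hti m).norm (integrable_const (2 * (q * ‖u‖) ^ m))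
      fun x => norm_powerSum_term_le hq u (hsub x.2) m).trans (le_of_eq ?_)
    rw [integral_const, hn, smul_eq_mul]
  have hsum : Summable fun m =>
      ∫ x : spectrum ℝ (adjOp G (q + 1) fun v => (hG v).le), ‖t m x‖ ∂μ :=
    (hgeom.mul_left _).of_nonneg_of_le (fun m => integral_nonneg fun x => norm_nonneg _) hbd
  have hW := hasSum_integral_of_summable_integral_norm hti hsum
  have hterm : ∀ m, ∫ x : spectrum ℝ (adjOp G (q + 1) fun v => (hG v).le), t m x ∂μ =
      trace F (powerSum q (adjOp G (q + 1) fun v => (hG v).le) m) * u ^ m / m := by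
    intro m
    rw [← cfc_powerSum hA, htr _ (continuous_powerSum q m).continuousOn, ← integral_mul_const,
      ← integral_div]
  simp only [hterm] at hW
  refine ⟨_, hW, ?_⟩
  rw [← integral_neg]
  refine hdet u (ball_subset_holomorphyDomain hq (by simpa using hu))
      (fun x => -∑' m, t m x) (ContinuousOn.neg ?_) fun x hx => exp_tsum_powerSum hq hu hx
  exact continuousOn_tsum (fun m => (htc m).continuousOn) hgeom
      fun m x hx => norm_powerSum_term_le hq u hx m

end PowerSums

/-! ### Free actions -/

section Free

variable {V : Type*} {G : SimpleGraph V} {Γ : Subgroup (G ≃g G)}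

theorem ActsFreely.eq_of_apply_eq (h : ActsFreely Γ) {γ δ : G ≃g G} (hγ : γ ∈ Γ) (hδ : δ ∈ Γ)
    {x : V} (hx : γ x = δ x) : γ = δ := by
  by_contra hne
  refine (h (δ⁻¹ * γ) (Γ.mul_mem (Γ.inv_mem hδ) hγ) fun h1 => hne ?_).1 x ?_
  · rwa [inv_mul_eq_one, eq_comm] at h1
  · rw [RelIso.mul_apply, hx, RelIso.inv_apply_self]

theorem IsRepresentatives.exists_carry {F : Finset V} (hF : IsRepresentatives Γ F) (x : V) :
    ∃ γ ∈ Γ, γ x ∈ F := by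
  obtain ⟨y, ⟨hy, γ, hγ, rfl⟩, -⟩ := hF x
  exact ⟨γ, hγ, hy⟩

theorem IsRepresentatives.eq_of_mem (hfree : ActsFreely Γ) {F : Finset V}
    (hF : IsRepresentatives Γ F) {γ δ : G ≃g G} (hγ : γ ∈ Γ) (hδ : δ ∈ Γ) {x : V}
    (h1 : γ x ∈ F) (h2 : δ x ∈ F) : γ = δ :=
  hfree.eq_of_apply_eq hγ hδ
    ((hF x).unique ⟨h1, γ, hγ, rfl⟩ ⟨h2, δ, hδ, rfl⟩)

/-- The element of `Γ` that carries `x` into the set of representatives. -/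
def carry {F : Finset V} (hF : IsRepresentatives Γ F) (x : V) : G ≃g G := (hF.exists_carry x).choose

theorem carry_mem {F : Finset V} (hF : IsRepresentatives Γ F) (x : V) : carry hF x ∈ Γ :=
  (hF.exists_carry x).choose_spec.1

theorem carry_apply_mem {F : Finset V} (hF : IsRepresentatives Γ F) (x : V) : carry hF x x ∈ F :=
  (hF.exists_carry x).choose_spec.2

theorem carry_eq (hfree : ActsFreely Γ) {F : Finset V} (hF : IsRepresentatives Γ F)
    {γ : G ≃g G} (hγ : γ ∈ Γ) {x : V} (h : γ x ∈ F) : carry hF x = γ :=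
  hF.eq_of_mem hfree (carry_mem hF x) hγ (carry_apply_mem hF x) h

/-- A sum over oriented edges modulo `Γ` may be taken over the edges that start, or over the edges
that end, in the set of representatives. -/
theorem sum_neighbor_swap [G.LocallyFinite] (hfree : ActsFreely Γ) {F : Finset V}
    (hF : IsRepresentatives Γ F) {R : Type*} [AddCommMonoid R] (k : V → V → R)
    (hk : ∀ γ ∈ Γ, ∀ x y, k (γ x) (γ y) = k x y) :
    ∑ x ∈ F, ∑ y ∈ G.neighborFinset x, k x y = ∑ x ∈ F, ∑ y ∈ G.neighborFinset x, k y x := by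
  rw [Finset.sum_sigma', Finset.sum_sigma']
  -- The bijection reverses an edge and translates it by the element of Γ that brings its new origin
  -- into F. It is an involution, since the element for the way back is the inverse.
  have hmaps : ∀ a : (_ : V) × V, a ∈ F.sigma (fun x => G.neighborFinset x) →
      (⟨carry hF a.2 a.2, carry hF a.2 a.1⟩ : (_ : V) × V) ∈
        F.sigma (fun x => G.neighborFinset x) := by
    rintro ⟨x, y⟩ h
    simp only [Finset.mem_sigma, SimpleGraph.mem_neighborFinset] at h ⊢
    exact ⟨carry_apply_mem hF y, (RelIso.map_rel_iff (carry hF y)).2 h.2.symm⟩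
  have hinv : ∀ a : (_ : V) × V, a ∈ F.sigma (fun x => G.neighborFinset x) →
      (⟨carry hF (carry hF a.2 a.1) (carry hF a.2 a.1),
        carry hF (carry hF a.2 a.1) (carry hF a.2 a.2)⟩ : (_ : V) × V) = a := by
    rintro ⟨x, y⟩ h
    simp only [Finset.mem_sigma, SimpleGraph.mem_neighborFinset] at h ⊢
    have h1 : carry hF (carry hF y x) = (carry hF y)⁻¹ :=
      carry_eq hfree hF (Γ.inv_mem (carry_mem hF y)) (by rw [RelIso.inv_apply_self]; exact h.1)
    rw [h1, RelIso.inv_apply_self, RelIso.inv_apply_self]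
  refine Finset.sum_bij' (fun a _ => ⟨carry hF a.2 a.2, carry hF a.2 a.1⟩)
    (fun a _ => ⟨carry hF a.2 a.2, carry hF a.2 a.1⟩) hmaps hmaps hinv hinv ?_
  rintro ⟨x, y⟩ -
  exact (hk _ (carry_mem hF y) x y).symm

end Free

/-! ### Counting walks without backtracking -/

section Step

open Classical in
/-- The indicator function of the oriented edge `(x, y)`. -/
def edgeDelta {V : Type*} (x y : V) : V → V → ℂ := fun a b => if a = x then if b = y then 1 else 0 else 0

theorem edgeDelta_map {V : Type*} {G : SimpleGraph V} (γ : G ≃g G) (x y : V) :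
    (fun a b => edgeDelta (γ x) (γ y) (γ a) (γ b)) = edgeDelta x y := by
  classical
  funext a b
  exact if_congr γ.injective.eq_iff (if_congr γ.injective.eq_iff rfl rfl) rfl

variable {V : Type*} (G : SimpleGraph V) [G.LocallyFinite]

open Classical in
/-- The transfer operator on functions of oriented edges: the value at `(x, y)` is the sum of the
values at the oriented edges `(y, z)` with `z ≠ x`. -/
def step : Module.End ℂ (V → V → ℂ) where
  toFun h x y := ∑ z ∈ (G.neighborFinset y).erase x, h y z
  map_add' _ _ := funext fun _ => funext fun _ => Finset.sum_add_distrib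
  map_smul' _ _ := funext fun _ => funext fun _ => (Finset.mul_sum _ _ _).symm

open Classical in
theorem step_apply (h : V → V → ℂ) (x y : V) :
    step G h x y = ∑ z ∈ (G.neighborFinset y).erase x, h y z := rfl

theorem step_apply_of_adj (h : V → V → ℂ) {x y : V} (hxy : G.Adj x y) :
    step G h x y = ∑ z ∈ G.neighborFinset y, h y z - h y x := by
  classical
  rw [step_apply, Finset.sum_erase_eq_sub]
  exact (G.mem_neighborFinset y x).2 hxy.symm

theorem step_pow_succ_apply_of_adj (m : ℕ) (h : V → V → ℂ) {x y : V} (hxy : G.Adj x y) :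
    (step G ^ (m + 1)) h x y =
      ∑ z ∈ G.neighborFinset y, (step G ^ m) h y z - (step G ^ m) h y x := by
  rw [pow_succ', Module.End.mul_apply, step_apply_of_adj G _ hxy]

/-- Functions are given on all pairs, but `step` reads them only at adjacent ones; identities below
therefore need to hold only on oriented edges. -/
theorem step_congr {h h' : V → V → ℂ} (hh : ∀ a b, G.Adj a b → h a b = h' a b) :
    step G h = step G h' := by
  classical
  refine funext fun x => funext fun y => ?_
  rw [step_apply, step_apply]
  refine Finset.sum_congr rfl fun z hz => hh y z ?_
  exact (G.mem_neighborFinset y z).1 (Finset.mem_of_mem_erase hz)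

theorem step_pow_congr {h h' : V → V → ℂ} (hh : ∀ a b, G.Adj a b → h a b = h' a b) (m : ℕ)
    {x y : V} (hxy : G.Adj x y) : (step G ^ m) h x y = (step G ^ m) h' x y := by
  cases m with
  | zero => exact hh x y hxy
  | succ m => rw [pow_succ, Module.End.mul_apply, Module.End.mul_apply, step_congr G hh]

/-- The sum of `g` over the end points of the walks of length `m + 1` from `x` that do not
backtrack. -/
def nbSum (m : ℕ) (g : V → ℂ) (x : V) : ℂ :=
  ∑ y ∈ G.neighborFinset x, (step G ^ m) (fun _ b => g b) x y

variable {G} in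
theorem card_neighborFinset_of_regular {q : ℕ} (hG : G.IsRegularOfDegree (q + 1)) (x : V) :
    (G.neighborFinset x).card = q + 1 := hG x

/-- All q + 1 walks x → y → x are removed. In `nbSum_add_two` the correction has q instead: after a
return to x the next edge must avoid y, so each continuation leaves only q choices of y. -/
theorem nbSum_one {q : ℕ} (hG : G.IsRegularOfDegree (q + 1)) (g : V → ℂ) (x : V) :
    nbSum G 1 g x = ∑ y ∈ G.neighborFinset x, nbSum G 0 g y - (q + 1) * g x := by
  have h : ∀ y ∈ G.neighborFinset x, (step G ^ 1) (fun _ b => g b) x y = nbSum G 0 g y - g x :=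
    fun y hy => step_pow_succ_apply_of_adj G 0 _ ((G.mem_neighborFinset x y).1 hy)
  rw [nbSum, Finset.sum_congr rfl h, Finset.sum_sub_distrib, Finset.sum_const,
    card_neighborFinset_of_regular hG, nsmul_eq_mul]
  push_cast
  rfl

theorem nbSum_add_two {q : ℕ} (hG : G.IsRegularOfDegree (q + 1)) (m : ℕ) (g : V → ℂ) (x : V) :
    nbSum G (m + 2) g x =
      ∑ y ∈ G.neighborFinset x, nbSum G (m + 1) g y - q * nbSum G m g x := by
  have h : ∀ y ∈ G.neighborFinset x, (step G ^ (m + 2)) (fun _ b => g b) x y =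
      nbSum G (m + 1) g y - (nbSum G m g x - (step G ^ m) (fun _ b => g b) x y) := by
    intro y hy
    have hxy := (G.mem_neighborFinset x y).1 hy
    rw [step_pow_succ_apply_of_adj G (m + 1) _ hxy, step_pow_succ_apply_of_adj G m _ hxy.symm]
    rfl
  rw [nbSum, Finset.sum_congr rfl h, Finset.sum_sub_distrib, Finset.sum_sub_distrib,
    Finset.sum_const, card_neighborFinset_of_regular hG, nsmul_eq_mul, ← nbSum]
  push_cast
  ring

theorem step_pow_map (γ : G ≃g G) (m : ℕ) (h : V → V → ℂ) (x y : V) :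
    (step G ^ m) h (γ x) (γ y) = (step G ^ m) (fun a b => h (γ a) (γ b)) x y := by
  classical
  induction m generalizing x y with
  | zero => rfl
  | succ m ih =>
    rw [pow_succ', Module.End.mul_apply, Module.End.mul_apply, step_apply, step_apply]
    refine (Finset.sum_bij (fun z _ => γ z) ?_ ?_ ?_ ?_).symm
    · intro z hz
      rw [Finset.mem_erase, SimpleGraph.mem_neighborFinset] at hz ⊢
      exact ⟨fun hh => hz.1 (γ.injective hh), (RelIso.map_rel_iff γ).2 hz.2⟩
    · exact fun a _ b _ hab => γ.injective hab
    · intro z hz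
      rw [Finset.mem_erase, SimpleGraph.mem_neighborFinset] at hz
      refine ⟨γ.symm z, ?_, γ.apply_symm_apply z⟩
      rw [Finset.mem_erase, SimpleGraph.mem_neighborFinset]
      refine ⟨fun hh => hz.1 ?_, ?_⟩
      · rw [← hh]; exact (γ.apply_symm_apply z).symm
      · rw [← RelIso.map_rel_iff γ, γ.apply_symm_apply]; exact hz.2
    · exact fun z _ => (ih y z).symm

-- The edges that may precede (x, y) are those that end at x, except its reverse (y, x).
open Classical in
theorem step_edgeDelta {x y : V} (hxy : G.Adj x y) {a b : V} (hab : G.Adj a b) :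
    step G (edgeDelta x y) a b =
      (fun _ b => (Pi.single x 1 : V → ℂ) b) a b - edgeDelta y x a b := by
  rw [step_apply_of_adj G _ hab]
  by_cases hb : b = x
  · subst hb
    have : y ∈ G.neighborFinset b := (G.mem_neighborFinset b y).2 hxy
    simp [edgeDelta, this]

  · simp [edgeDelta, hb]

open Classical in
theorem sum_edgeDelta (x : V) {a b : V} (hab : G.Adj a b) :
    (∑ y ∈ G.neighborFinset x, edgeDelta x y) a b = (Pi.single x 1 : V → ℂ) a := by
  rw [Finset.sum_apply, Finset.sum_apply]
  by_cases ha : a = x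
  · subst ha
    have : b ∈ G.neighborFinset a := (G.mem_neighborFinset a b).2 hab
    simp [edgeDelta, this]
  · simp [edgeDelta, ha]

theorem step_start {q : ℕ} (hG : G.IsRegularOfDegree (q + 1)) (g : V → ℂ) {a b : V}
    (hab : G.Adj a b) :
    step G (fun a _ => g a) a b = ((q : ℂ) • fun (_ : V) (b : V) => g b) a b := by
  rw [step_apply_of_adj G _ hab, Finset.sum_const, card_neighborFinset_of_regular hG]
  simp
  ring

/-- The weighted number of reduced closed paths of length `m` modulo `Γ`. -/
def cycleSum (F : Finset V) (m : ℕ) : ℂ :=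
  ∑ x ∈ F, ∑ y ∈ G.neighborFinset x, (step G ^ m) (edgeDelta x y) x y

/-- The weighted number of closed walks of length `m` without backtracking, modulo `Γ`, whose last
edge is the reverse of the first. -/
def tailSum (F : Finset V) (m : ℕ) : ℂ :=
  ∑ x ∈ F, ∑ y ∈ G.neighborFinset x, (step G ^ m) (edgeDelta y x) x y

open Classical in
/-- The weighted number of closed walks of length `m + 1` without backtracking, modulo `Γ`. -/
def nbTrace (F : Finset V) (m : ℕ) : ℂ := ∑ x ∈ F, nbSum G m (Pi.single x 1) x

/-- Cyclically reduced paths are the closed walks without backtracking whose last edge is not the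
reverse of the first. -/
theorem cycleSum_succ (F : Finset V) (m : ℕ) :
    cycleSum G F (m + 1) = nbTrace G F m - tailSum G F m := by
  classical
  rw [cycleSum, nbTrace, tailSum, ← Finset.sum_sub_distrib]
  refine Finset.sum_congr rfl fun x _ => ?_
  rw [nbSum, ← Finset.sum_sub_distrib]
  refine Finset.sum_congr rfl fun y hy => ?_
  have hxy := (G.mem_neighborFinset x y).1 hy
  rw [pow_succ, Module.End.mul_apply, step_pow_congr G (h' := (fun _ b => (Pi.single x 1 : V → ℂ) b) -
    edgeDelta y x) (fun a b hab => step_edgeDelta G hxy hab) m hxy, map_sub]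
  rfl

theorem tailSum_zero (F : Finset V) : tailSum G F 0 = 0 := by
  refine Finset.sum_eq_zero fun x _ => Finset.sum_eq_zero fun y hy => ?_
  have hxy := ((G.mem_neighborFinset x y).1 hy).ne
  simp [edgeDelta, hxy]

theorem tailSum_one (F : Finset V) : tailSum G F 1 = 0 := by
  classical
  refine Finset.sum_eq_zero fun x _ => Finset.sum_eq_zero fun y hy => ?_
  have hxy := (G.mem_neighborFinset x y).1 hy
  rw [step_pow_succ_apply_of_adj G 0 _ hxy]
  have : x ∈ G.neighborFinset y := (G.mem_neighborFinset y x).2 hxy.symm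
  simp [edgeDelta, this]

/-- Remove the tail edge: what is left of x → y → … → y → x is a closed walk at y without
backtracking. Each such walk can be continued to x in q ways at its end, and one must discard the
continuations for which its first edge is (y, x); these are counted by `cycleSum`. The walks that
remain are based at y, so `sum_neighbor_swap` moves the condition of lying in F from x to y. -/
theorem tailSum_add_two {Γ : Subgroup (G ≃g G)} (hfree : ActsFreely Γ) {F : Finset V}
    (hF : IsRepresentatives Γ F) {q : ℕ} (hG : G.IsRegularOfDegree (q + 1)) (m : ℕ) :
    tailSum G F (m + 2) = q * nbTrace G F m - cycleSum G F (m + 1) := by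
  classical
  have h1 : tailSum G F (m + 2) = ∑ x ∈ F, ∑ y ∈ G.neighborFinset x,
      (∑ z ∈ G.neighborFinset y, (step G ^ (m + 1)) (edgeDelta y x) y z) -
      ∑ x ∈ F, ∑ y ∈ G.neighborFinset x, (step G ^ (m + 1)) (edgeDelta y x) y x := by
    rw [tailSum, ← Finset.sum_sub_distrib]
    refine Finset.sum_congr rfl fun x _ => ?_
    rw [← Finset.sum_sub_distrib]
    refine Finset.sum_congr rfl fun y hy => ?_
    exact step_pow_succ_apply_of_adj G (m + 1) _ ((G.mem_neighborFinset x y).1 hy)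
  have h2 : ∑ x ∈ F, ∑ y ∈ G.neighborFinset x, (step G ^ (m + 1)) (edgeDelta y x) y x =
      cycleSum G F (m + 1) :=
    sum_neighbor_swap hfree hF (fun x y => (step G ^ (m + 1)) (edgeDelta y x) y x)
      (fun γ _ x y => by rw [step_pow_map, edgeDelta_map])
  have h3 := sum_neighbor_swap hfree hF
    (fun x y => ∑ z ∈ G.neighborFinset y, (step G ^ (m + 1)) (edgeDelta y x) y z)
    (fun γ _ x y => by
      refine (Finset.sum_bij (fun z _ => γ z) ?_ ?_ ?_ ?_).symm
      · intro z hz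
        rw [SimpleGraph.mem_neighborFinset] at hz ⊢
        exact (RelIso.map_rel_iff γ).2 hz
      · exact fun a _ b _ hab => γ.injective hab
      · intro z hz
        rw [SimpleGraph.mem_neighborFinset] at hz
        refine ⟨γ.symm z, ?_, γ.apply_symm_apply z⟩
        rw [SimpleGraph.mem_neighborFinset, ← RelIso.map_rel_iff γ, γ.apply_symm_apply]
        exact hz
      · exact fun z _ => by rw [step_pow_map, edgeDelta_map])
  rw [h1, h2, h3, nbTrace, Finset.mul_sum]
  congr 1
  refine Finset.sum_congr rfl fun x _ => ?_
  rw [Finset.sum_comm, nbSum, Finset.mul_sum]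
  refine Finset.sum_congr rfl fun z hz => ?_
  have hxz := (G.mem_neighborFinset x z).1 hz
  have h4 : ∑ y ∈ G.neighborFinset x, (step G ^ (m + 1)) (edgeDelta x y) x z =
      (step G ^ (m + 1)) (∑ y ∈ G.neighborFinset x, edgeDelta x y) x z := by
    rw [map_sum, Finset.sum_apply, Finset.sum_apply]
  rw [h4, step_pow_congr G (h' := fun a _ => (Pi.single x 1 : V → ℂ) a)
    (fun a b hab => sum_edgeDelta G x hab) (m + 1) hxz, pow_succ, Module.End.mul_apply,
    step_pow_congr G (fun a b hab => step_start G hG _ hab) m hxz, map_smul]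
  rfl

end Step

/-! ### The counting polynomials -/

section Polynomials

/-- The polynomials that count walks of length `m + 1` without backtracking. -/
def nbPoly {R : Type*} [Ring R] (q : ℕ) (x : R) : ℕ → R
  | 0 => x
  | 1 => x * x - (q + 1)
  | m + 2 => x * nbPoly q x (m + 1) - q * nbPoly q x m

theorem map_powerSum {R S : Type*} [Ring R] [Ring S] (φ : R →+* S) (q : ℕ) (x : R) (m : ℕ) :
    φ (powerSum q x m) = powerSum q (φ x) m := by
  induction m using Nat.twoStepInduction with
  | zero => exact map_ofNat φ 2
  | one => simp [powerSum]
  | more m h1 h2 => simp [powerSum, h1, h2]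

theorem map_nbPoly {R S : Type*} [Ring R] [Ring S] (φ : R →+* S) (q : ℕ) (x : R) (m : ℕ) :
    φ (nbPoly q x m) = nbPoly q (φ x) m := by
  induction m using Nat.twoStepInduction with
  | zero => simp [nbPoly]
  | one => simp [nbPoly]
  | more m h1 h2 => simp [nbPoly, h1, h2]

theorem nbPoly_sub_comm {R : Type*} [CommRing R] (q : ℕ) (x : R) (m : ℕ) :
    nbPoly q x (m + 2) - q * nbPoly q x m = powerSum q x (m + 3) - powerSum q x (m + 1) := by
  induction m using Nat.twoStepInduction with
  | zero => simp only [nbPoly, powerSum]; ring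
  | one => simp only [nbPoly, powerSum]; ring
  | more m h1 h2 =>
    have e1 : nbPoly q x (m + 2 + 2) = x * nbPoly q x (m + 1 + 2) - q * nbPoly q x (m + 2) := rfl
    have e2 : nbPoly q x (m + 2) = x * nbPoly q x (m + 1) - q * nbPoly q x m := rfl
    have e3 : powerSum q x (m + 2 + 3) =
      x * powerSum q x (m + 1 + 3) - q * powerSum q x (m + 3) := rfl
    have e4 : powerSum q x (m + 2 + 1) =
      x * powerSum q x (m + 1 + 1) - q * powerSum q x (m + 1) := rfl
    linear_combination e1 - q * e2 - e3 + e4 + x * h2 - q * h1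

/-- Operators do not commute in general, so the identity is proved in ℤ[X] and evaluated at x. -/
theorem nbPoly_sub {R : Type*} [Ring R] (q : ℕ) (x : R) (m : ℕ) :
    nbPoly q x (m + 2) - q * nbPoly q x m = powerSum q x (m + 3) - powerSum q x (m + 1) := by
  let φ : Polynomial ℤ →+* R := (Polynomial.aeval x : Polynomial ℤ →ₐ[ℤ] R).toRingHom
  have hφ : φ Polynomial.X = x := Polynomial.aeval_X x
  have h := congrArg φ (nbPoly_sub_comm q (Polynomial.X : Polynomial ℤ) m)
  rwa [map_sub, map_sub, map_mul, map_natCast, map_nbPoly, map_nbPoly, map_powerSum,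
    map_powerSum, hφ] at h

variable {V : Type*} (G : SimpleGraph V) [G.LocallyFinite]

theorem nbPoly_adjOp_apply {q : ℕ} (hG : G.IsRegularOfDegree (q + 1)) (m : ℕ) (f : L2 V) (x : V) :
    nbPoly q (adjOp G (q + 1) fun v => (hG v).le) m f x = nbSum G m f x := by
  have hnat : ∀ (n : ℕ) (g : L2 V), (n : L2 V →L[ℂ] L2 V) g = (n : ℂ) • g := fun n g => by
    rw [← nsmul_one, smul_apply, one_apply_eq_self,
      Nat.cast_smul_eq_nsmul]
  induction m using Nat.twoStepInduction generalizing x with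
  | zero => rfl
  | one =>
    rw [nbSum_one G hG]
    have h1 : nbPoly q (adjOp G (q + 1) fun v => (hG v).le) 1 f =
      adjOp G (q + 1) (fun v => (hG v).le) (adjOp G (q + 1) (fun v => (hG v).le) f) -
        ((q : L2 V →L[ℂ] L2 V) f + f) := rfl
    rw [h1, hnat, lp.coeFn_sub, Pi.sub_apply, adjOp_apply, lp.coeFn_add, Pi.add_apply,
      lp.coeFn_smul, Pi.smul_apply, smul_eq_mul, add_mul, one_mul]
    rfl
  | more m h1 h2 =>
    rw [nbSum_add_two G hG]
    have h3 : nbPoly q (adjOp G (q + 1) fun v => (hG v).le) (m + 2) f =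
      adjOp G (q + 1) (fun v => (hG v).le)
        (nbPoly q (adjOp G (q + 1) fun v => (hG v).le) (m + 1) f) -
        (q : L2 V →L[ℂ] L2 V) (nbPoly q (adjOp G (q + 1) fun v => (hG v).le) m f) := rfl
    rw [h3, hnat, lp.coeFn_sub, Pi.sub_apply, adjOp_apply, lp.coeFn_smul, Pi.smul_apply,
      smul_eq_mul, h1]
    simp only [h2]

theorem trace_nbPoly {q : ℕ} (hG : G.IsRegularOfDegree (q + 1)) (F : Finset V) (m : ℕ) :
    trace F (nbPoly q (adjOp G (q + 1) fun v => (hG v).le) m) = nbTrace G F m := by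
  classical
  refine Finset.sum_congr rfl fun x _ => ?_
  rw [nbPoly_adjOp_apply G hG, lp.coeFn_single]

theorem trace_add (F : Finset V) (S T : L2 V →L[ℂ] L2 V) :
    trace F (S + T) = trace F S + trace F T := by
  simp [trace, Finset.sum_add_distrib]

theorem trace_sub (F : Finset V) (S T : L2 V →L[ℂ] L2 V) :
    trace F (S - T) = trace F S - trace F T := by
  simp [trace, Finset.sum_sub_distrib]

theorem trace_natCast_mul (F : Finset V) (n : ℕ) (T : L2 V →L[ℂ] L2 V) :
    trace F (n * T) = n * trace F T := by
  rw [← nsmul_eq_mul]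
  simp [trace, Finset.mul_sum]

/-- `cycleSum_succ` and `tailSum_add_two` give N_{m+3} - N_{m+1} = t_{m+2} - q t_m, where t_m is the
trace of `nbPoly`. By `nbPoly_sub` this is the corresponding difference of the traces of `powerSum`.
Thus N_m minus that trace depends only on the parity of m; it is 0 for m = 1 and |F|(q-1) for m = 2.
-/
theorem cycleSum_eq_trace {Γ : Subgroup (G ≃g G)} (hfree : ActsFreely Γ) {F : Finset V}
    (hF : IsRepresentatives Γ F) {q : ℕ} (hG : G.IsRegularOfDegree (q + 1)) (m : ℕ) :
    cycleSum G F (m + 1) = trace F (powerSum q (adjOp G (q + 1) fun v => (hG v).le) (m + 1)) +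
      F.card * (q - 1) * ((1 + (-1) ^ (m + 1)) / 2) := by
  induction m using Nat.twoStepInduction with
  | zero =>
    rw [cycleSum_succ, tailSum_zero, ← trace_nbPoly G hG]
    simp [nbPoly, powerSum]
  | one =>
    rw [cycleSum_succ, tailSum_one, ← trace_nbPoly G hG]
    have h1 : nbPoly q (adjOp G (q + 1) fun v => (hG v).le) 1 =
      powerSum q (adjOp G (q + 1) fun v => (hG v).le) 2 + (q : L2 V →L[ℂ] L2 V) * 1 - 1 := by
      simp only [nbPoly, powerSum]
      rw [mul_two, mul_one]; abel
    rw [h1, trace_sub, trace_add, trace_natCast_mul, trace_one]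
    norm_num
    ring
  | more m h1 h2 =>
    rw [cycleSum_succ, tailSum_add_two G hfree hF hG, h1, ← trace_nbPoly G hG, ← trace_nbPoly G hG]
    have h3 := congrArg (trace F) (nbPoly_sub q (adjOp G (q + 1) fun v => (hG v).le) m)
    rw [trace_sub, trace_sub, trace_natCast_mul] at h3
    rw [show m + 2 + 1 = m + 3 from rfl, pow_add (-1 : ℂ) m 3, pow_succ (-1 : ℂ) m]
    linear_combination h3

end Polynomials

/-! ### Reduced closed paths -/

namespace ClosedPath

variable {V : Type*} {G : SimpleGraph V}

theorem vert_mod (C : ClosedPath G) (j : ℕ) : C.vert (j % C.len) = C.vert j := by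
  conv_rhs => rw [← Nat.mod_add_div j C.len, mul_comm, vert_add_mul]

theorem one_lt_len (C : ClosedPath G) : 1 < C.len := by
  refine lt_of_le_of_ne C.len_pos fun h => ?_
  have h1 := C.adj 0
  rw [h, C.periodic] at h1
  exact h1.ne rfl

/-- A closed path is reduced if and only if it has no backtracking when it is read cyclically. -/
theorem isReduced_iff (C : ClosedPath G) :
    C.IsReduced ↔ ∀ j, C.vert j ≠ C.vert (j + 2) := by
  have h1 := C.one_lt_len
  have hlen : C.vert C.len = C.vert 0 := by simpa using C.periodic 0
  have hlen1 : C.vert (C.len + 1) = C.vert 1 := by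
    rw [add_comm]; exact C.periodic 1
  constructor
  · rintro ⟨hb, ht⟩
    have key : ∀ j, j < C.len → C.vert j ≠ C.vert (j + 2) := by
      intro j hj he
      rcases Nat.lt_or_ge (j + 1) C.len with h | h
      · exact hb ⟨j + 1, by omega, by omega, by simpa using he⟩
      · have hj : j = C.len - 1 := by omega
        have h2 : C.vert (j + 2) = C.vert 1 := by rw [← hlen1]; congr 1; omega
        rw [h2] at he
        -- The condition on tails is empty for length below 4. In length 2 there is backtracking at
        -- i = 1, and in length 3 the equality would identify adjacent vertices. From length 4 on, a
        -- tail with k = 1 appears.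
        rcases Nat.lt_or_ge C.len 4 with h4 | h4
        · rcases (by omega : C.len = 2 ∨ C.len = 3) with h3 | h3
          · refine hb ⟨1, le_rfl, by omega, ?_⟩
            rw [← hlen, h3]
          · have := C.adj 1
            rw [← he, hj, h3] at this
            exact this.ne rfl
        · refine ht ⟨1, le_rfl, by omega, fun i hi hi' => ?_⟩
          obtain rfl : i = 1 := by omega
          rw [← he, hj]
    intro j he
    apply key (j % C.len) (Nat.mod_lt _ C.len_pos)
    rw [vert_mod, he, ← vert_mod C (j % C.len + 2), ← vert_mod C (j + 2), Nat.mod_add_mod]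
  · intro h
    refine ⟨?_, ?_⟩
    · rintro ⟨i, hi, -, he⟩
      apply h (i - 1)
      rw [he]; congr 1; omega
    · rintro ⟨k, hk, hk', he⟩
      apply h (C.len - 1)
      rw [← he 1 le_rfl hk, ← hlen1]; congr 1; omega

theorem adj_vert_mod {m : ℕ} (hm : 0 < m) {w : ℕ → V} (hw : ∀ i ≤ m, G.Adj (w i) (w (i + 1)))
    (h0 : w m = w 0) (j : ℕ) : G.Adj (w (j % m)) (w ((j + 1) % m)) := by
  have hj := Nat.mod_lt j hm
  have h1 := hw (j % m) hj.le
  rcases Nat.lt_or_ge (j % m + 1) m with h | h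
  · rwa [← Nat.mod_add_mod, Nat.mod_eq_of_lt h]
  · have h2 : j % m + 1 = m := by omega
    rw [← Nat.mod_add_mod, h2, Nat.mod_self, ← h0]
    rwa [h2] at h1

end ClosedPath

/-! ### Walks without backtracking as sequences of vertices -/

section Sequences

variable {V : Type*} (G : SimpleGraph V)

/-- Sequences that start with the oriented edge `(x, y)`, make `m` steps without backtracking and
end with the oriented edge `(x', y')`; they are constant afterwards. -/
def NBSeq (m : ℕ) (x y x' y' : V) : Type _ :=
  {w : ℕ → V // w 0 = x ∧ w 1 = y ∧ w m = x' ∧ w (m + 1) = y' ∧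
    (∀ i < m, G.Adj (w (i + 1)) (w (i + 2)) ∧ w (i + 2) ≠ w i) ∧ ∀ i > m, w i = y'}

/-- A sequence with one more step is determined by its second edge and the rest. -/
def nbSeqSuccEquiv (m : ℕ) (x y x' y' : V) :
    NBSeq G (m + 1) x y x' y' ≃
      Σ z : {z : V // G.Adj y z ∧ z ≠ x}, NBSeq G m y z x' y' where
  toFun w := ⟨⟨w.1 2, by
      have := w.2.2.2.2.2.1 0 (Nat.succ_pos m)
      rw [w.2.1, w.2.2.1] at this
      exact this⟩,
    ⟨fun i => w.1 (i + 1), w.2.2.1, rfl, w.2.2.2.1, w.2.2.2.2.1,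
      fun i hi => w.2.2.2.2.2.1 (i + 1) (by omega), fun i hi => w.2.2.2.2.2.2 (i + 1) (by omega)⟩⟩
  invFun p := ⟨fun i => Nat.casesOn i x p.2.1, rfl, p.2.2.1, p.2.2.2.2.1, p.2.2.2.2.2.1, by
      rintro (_ | i) hi
      · change G.Adj (p.2.1 0) (p.2.1 1) ∧ p.2.1 1 ≠ x
        rw [p.2.2.1, p.2.2.2.1]
        exact p.1.2
      · exact p.2.2.2.2.2.2.1 i (by omega), by
      rintro (_ | i) hi
      · omega
      · exact p.2.2.2.2.2.2.2 i (by omega)⟩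
  left_inv w := by
    refine Subtype.ext (funext fun i => ?_)
    cases i with
    | zero => exact w.2.1.symm
    | succ i => rfl
  right_inv p := by
    obtain ⟨⟨z, hz⟩, w, hw⟩ := p
    obtain rfl : w 1 = z := hw.2.1
    rfl

/-- This is what makes powers of `step` count walks: splitting off the first edge of a walk is one
application of `step`. -/
theorem finite_card_nbSeq [G.LocallyFinite] (m : ℕ) (x y x' y' : V) :
    Finite (NBSeq G m x y x' y') ∧
      (Nat.card (NBSeq G m x y x' y') : ℂ) = (step G ^ m) (edgeDelta x' y') x y := by
  classical
  induction m generalizing x y with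
  | zero =>
    have hsub : Subsingleton (NBSeq G 0 x y x' y') := by
      refine ⟨fun w w' => Subtype.ext (funext fun i => ?_)⟩
      cases i with
      | zero => rw [w.2.1, w'.2.1]
      | succ i => rw [w.2.2.2.2.2.2 _ (Nat.succ_pos i), w'.2.2.2.2.2.2 _ (Nat.succ_pos i)]
    refine ⟨inferInstance, ?_⟩
    change _ = edgeDelta x' y' x y
    by_cases h : x = x' ∧ y = y'
    · obtain ⟨rfl, rfl⟩ := h
      have : Nonempty (NBSeq G 0 x y x y) :=
        ⟨⟨fun i => Nat.casesOn i x fun _ => y, rfl, rfl, rfl, rfl, fun i hi => by omega, by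
          rintro (_ | i) hi
          · omega
          · rfl⟩⟩
      rw [Nat.card_eq_one_iff_unique.2 ⟨hsub, this⟩]
      simp [edgeDelta]
    · have : IsEmpty (NBSeq G 0 x y x' y') :=
        ⟨fun w => h ⟨w.2.1.symm.trans w.2.2.2.1, w.2.2.1.symm.trans w.2.2.2.2.1⟩⟩
      rw [Nat.card_of_isEmpty, edgeDelta]
      by_cases h1 : x = x'
      · have h2 : y ≠ y' := fun h2 => h ⟨h1, h2⟩
        simp [h1, h2]
      · simp [h1]
  | succ m ih =>
    have hfin : Finite {z : V // G.Adj y z ∧ z ≠ x} :=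
      ((G.neighborFinset y).finite_toSet.subset fun z hz =>
        (G.mem_neighborFinset y z).2 hz.1).to_subtype
    have : ∀ z : {z : V // G.Adj y z ∧ z ≠ x}, Finite (NBSeq G m y z x' y') :=
      fun z => (ih y z).1
    refine ⟨Finite.of_equiv _ (nbSeqSuccEquiv G m x y x' y').symm, ?_⟩
    have := Fintype.ofFinite {z : V // G.Adj y z ∧ z ≠ x}
    rw [Nat.card_congr (nbSeqSuccEquiv G m x y x' y'), Nat.card_sigma, pow_succ',
      Module.End.mul_apply, step_apply, Nat.cast_sum]
    refine (Finset.sum_congr rfl fun (z : {z : V // G.Adj y z ∧ z ≠ x}) _ => (ih y z).2).trans ?_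
    refine (Finset.sum_subtype _ (fun z => ?_) _).symm
    rw [Finset.mem_erase, SimpleGraph.mem_neighborFinset, and_comm]

/-- Reduced closed paths of length `m` with a given first edge. -/
def reducedEquiv {m : ℕ} (hm : 0 < m) {x y : V} (hxy : G.Adj x y) :
    {C : ClosedPath G // C.IsReduced ∧ C.len = m ∧ C.vert 0 = x ∧ C.vert 1 = y} ≃
      NBSeq G m x y x y where
  -- The sequence goes once around and repeats the first edge at positions m, m + 1; in this way the
  -- absence of backtracking includes the closing point. The periodic tail is cut off to match the
  -- normal form of `NBSeq`.
  toFun C := ⟨fun i => if i ≤ m then C.1.vert i else y, by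
    obtain ⟨C, hC, rfl, rfl, rfl⟩ := C
    have h1 := C.one_lt_len
    have hlen1 : C.vert (C.len + 1) = C.vert 1 := by rw [add_comm]; exact C.periodic 1
    have hif : ∀ i ≤ C.len + 1, (if i ≤ C.len then C.vert i else C.vert 1) = C.vert i := by
      intro i hi
      split_ifs with h
      · rfl
      · rw [(by omega : i = C.len + 1), hlen1]
    refine ⟨?_, ?_, ?_, ?_, fun i hi => ?_, fun i hi => ?_⟩
    · simp
    · exact if_pos hm
    · simpa using C.periodic 0
    · exact if_neg (by omega)
    · dsimp only
      rw [hif _ (by omega), hif _ (by omega), hif _ (by omega)]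
      exact ⟨C.adj _, ((C.isReduced_iff.1 hC) i).symm⟩
    · exact if_neg (by omega)⟩
  invFun w :=
    have hadj : ∀ i ≤ m, G.Adj (w.1 i) (w.1 (i + 1)) := by
      rintro (_ | i) hi
      · rw [w.2.1, zero_add, w.2.2.1]; exact hxy
      · exact (w.2.2.2.2.2.1 i (by omega)).1
    have h0 : w.1 m = w.1 0 := by rw [w.2.1, w.2.2.2.1]
    have hm1 : 1 < m := by
      rcases Nat.lt_or_ge 1 m with h | h
      · exact h
      · obtain rfl : m = 1 := by omega
        exact absurd (hadj 0 (by omega)) (by rw [← h0]; exact SimpleGraph.irrefl G)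
    ⟨{ len := m
       len_pos := hm
       vert := fun j => w.1 (j % m)
       periodic := fun j => by rw [Nat.add_mod_right]
       adj := ClosedPath.adj_vert_mod hm hadj h0 }, by
      refine ⟨?_, rfl, ?_, ?_⟩
      · rw [ClosedPath.isReduced_iff]
        intro j he
        have hj := Nat.mod_lt j hm
        have h2 := (w.2.2.2.2.2.1 (j % m) hj).2
        apply h2
        refine Eq.trans ?_ he.symm
        change _ = w.1 ((j + 2) % m)
        rw [← Nat.mod_add_mod]
        rcases Nat.lt_or_ge (j % m + 2) m with h | h
        · rw [Nat.mod_eq_of_lt h]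
        · rcases (by omega : j % m + 2 = m ∨ j % m + 2 = m + 1) with h | h
          · rw [h, Nat.mod_self, h0]
          · rw [h, Nat.add_mod_left, Nat.mod_eq_of_lt hm1, w.2.2.2.2.1, w.2.2.1]
      · change w.1 (0 % m) = x
        rw [Nat.zero_mod, w.2.1]
      · change w.1 (1 % m) = y
        rw [Nat.mod_eq_of_lt hm1, w.2.2.1]⟩
  left_inv C := by
    obtain ⟨C, hC, rfl, rfl, rfl⟩ := C
    refine Subtype.ext (ClosedPath.ext rfl (funext fun j => ?_))
    change (if j % C.len ≤ C.len then C.vert (j % C.len) else _) = _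
    rw [if_pos (Nat.mod_lt _ hm).le, C.vert_mod]
  right_inv w := by
    refine Subtype.ext (funext fun i => ?_)
    change (if i ≤ m then w.1 (i % m) else y) = w.1 i
    split_ifs with h
    · rcases h.lt_or_eq with h | rfl
      · rw [Nat.mod_eq_of_lt h]
      · rw [Nat.mod_self, w.2.1, w.2.2.2.1]
    · exact (w.2.2.2.2.2.2 i (by omega)).symm

/-- The reduced closed paths that start in `F`. -/
def ReducedFrom (F : Finset V) : Type _ := {C : ClosedPath G // C.IsReduced ∧ C.vert 0 ∈ F}

theorem finite_card_reducedFrom [G.LocallyFinite] (F : Finset V) {m : ℕ} (hm : 0 < m) :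
    Finite {C : ReducedFrom G F // C.1.len = m} ∧
      (Nat.card {C : ReducedFrom G F // C.1.len = m} : ℂ) = cycleSum G F m := by
  classical
  let e : {C : ReducedFrom G F // C.1.len = m} ≃
      Σ x : F, Σ y : G.neighborFinset x.1, {C : ClosedPath G //
        C.IsReduced ∧ C.len = m ∧ C.vert 0 = x.1 ∧ C.vert 1 = y.1} :=
    { toFun := fun C => ⟨⟨C.1.1.vert 0, C.1.2.2⟩,
        ⟨C.1.1.vert 1, (G.mem_neighborFinset _ _).2 (C.1.1.adj 0)⟩,
        ⟨C.1.1, C.1.2.1, C.2, rfl, rfl⟩⟩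
      invFun := fun p => ⟨⟨p.2.2.1, p.2.2.2.1, by rw [p.2.2.2.2.2.1]; exact p.1.2⟩, p.2.2.2.2.1⟩
      left_inv := fun C => rfl
      right_inv := by
        rintro ⟨⟨x, hx⟩, ⟨y, hy⟩, ⟨C, h1, h2, h3, h4⟩⟩
        dsimp at h3 h4
        subst h3 h4
        rfl }
  have key : ∀ (x : F) (y : G.neighborFinset x.1),
      Finite {C : ClosedPath G // C.IsReduced ∧ C.len = m ∧ C.vert 0 = x.1 ∧ C.vert 1 = y.1} ∧
      (Nat.card {C : ClosedPath G //
        C.IsReduced ∧ C.len = m ∧ C.vert 0 = x.1 ∧ C.vert 1 = y.1} : ℂ) =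
        (step G ^ m) (edgeDelta x.1 y.1) x y := by
    intro x y
    have hxy := (G.mem_neighborFinset x.1 y.1).1 y.2
    obtain ⟨h1, h2⟩ := finite_card_nbSeq G m x.1 y.1 x.1 y.1
    exact ⟨Finite.of_equiv _ (reducedEquiv G hm hxy).symm, by
      rw [Nat.card_congr (reducedEquiv G hm hxy), h2]⟩
  have := fun x y => (key x y).1
  refine ⟨Finite.of_equiv _ e.symm, ?_⟩
  rw [Nat.card_congr e, Nat.card_sigma, Nat.cast_sum, cycleSum, ← Finset.sum_coe_sort F]
  refine Finset.sum_congr rfl fun x _ => ?_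
  rw [Nat.card_sigma, Nat.cast_sum, ← Finset.sum_coe_sort (G.neighborFinset x.1)]
  exact Finset.sum_congr rfl fun y _ => (key x y).2

end Sequences

/-! ### Primitive closed paths -/

namespace ClosedPath

variable {V : Type*} {G : SimpleGraph V}

/-- The shift of a sequence. -/
def seqShift (w : ℕ → V) : ℕ → V := fun j => w (j + 1)

theorem seqShift_iterate (n : ℕ) (w : ℕ → V) (j : ℕ) : seqShift^[n] w j = w (j + n) := by
  induction n generalizing w with
  | zero => rfl
  | succ n ih => rw [Function.iterate_succ_apply, ih]; rfl

theorem isPeriodicPt_seqShift {n : ℕ} {w : ℕ → V} :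
    Function.IsPeriodicPt seqShift n w ↔ ∀ j, w (j + n) = w j := by
  rw [Function.IsPeriodicPt, Function.IsFixedPt, funext_iff]
  simp only [seqShift_iterate]

/-- The least period of the sequence of vertices. -/
def period (C : ClosedPath G) : ℕ := Function.minimalPeriod seqShift C.vert

theorem isPeriodicPt (C : ClosedPath G) : Function.IsPeriodicPt seqShift C.len C.vert :=
  isPeriodicPt_seqShift.2 C.periodic

theorem period_dvd (C : ClosedPath G) : C.period ∣ C.len := C.isPeriodicPt.minimalPeriod_dvd

theorem period_pos (C : ClosedPath G) : 0 < C.period := C.isPeriodicPt.minimalPeriod_pos C.len_pos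

theorem vert_add_period (C : ClosedPath G) (j : ℕ) : C.vert (j + C.period) = C.vert j :=
  isPeriodicPt_seqShift.1 (Function.isPeriodicPt_minimalPeriod _ _) j

/-- The primitive closed path with the same sequence of vertices. -/
def root (C : ClosedPath G) : ClosedPath G where
  len := C.period
  len_pos := C.period_pos
  vert := C.vert
  periodic := C.vert_add_period
  adj := C.adj

/-- Going `n + 1` times around a closed path. -/
def power (C : ClosedPath G) (n : ℕ) : ClosedPath G where
  len := (n + 1) * C.len
  len_pos := Nat.mul_pos n.succ_pos C.len_pos
  vert := C.vert
  periodic := fun j => C.vert_add_mul j (n + 1)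
  adj := C.adj

/-- A closed path with shifted origin. -/
def rotate (C : ClosedPath G) (k : ℕ) : ClosedPath G where
  len := C.len
  len_pos := C.len_pos
  vert := fun j => C.vert (j + k)
  periodic := fun j => by rw [Nat.add_right_comm, C.periodic]
  adj := fun j => by rw [Nat.add_right_comm]; exact C.adj (j + k)

/-- The least period divides the length, and C runs len / period times around `root`. -/
theorem isPrimitive_iff (C : ClosedPath G) : C.IsPrimitive ↔ C.period = C.len := by
  constructor
  · intro h
    obtain ⟨n, hn⟩ := C.period_dvd
    by_contra hne
    refine h ⟨C.root, n, ?_, hn.trans (mul_comm _ _), fun _ => rfl⟩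
    have h0 := C.len_pos
    rcases n with _ | _ | n
    · omega
    · exact absurd (by omega) hne
    · omega
  · rintro h ⟨D, n, hn, hlen, hv⟩
    have h1 : C.period ∣ D.len := by
      refine Function.IsPeriodicPt.minimalPeriod_dvd (isPeriodicPt_seqShift.2 fun j => ?_)
      rw [hv, hv, D.periodic]
    have h2 := Nat.le_of_dvd D.len_pos h1
    have h3 := D.len_pos
    rw [h, hlen] at h2
    nlinarith

theorem IsReduced.of_vert {C D : ClosedPath G} (hC : C.IsReduced) (k : ℕ)
    (h : ∀ j, D.vert j = C.vert (j + k)) : D.IsReduced := by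
  rw [isReduced_iff] at hC ⊢
  intro j
  rw [h, h, Nat.add_right_comm]
  exact hC _

theorem root_isPrimitive (C : ClosedPath G) : C.root.IsPrimitive := C.root.isPrimitive_iff.2 rfl

theorem IsReduced.smul {C : ClosedPath G} (hC : C.IsReduced) (γ : G ≃g G) :
    (γ • C).IsReduced := by
  rw [isReduced_iff] at hC ⊢
  exact fun j h => hC j (γ.injective h)

theorem IsPrimitive.smul {C : ClosedPath G} (hC : C.IsPrimitive) (γ : G ≃g G) :
    (γ • C).IsPrimitive := by
  rintro ⟨D, n, hn, hlen, hv⟩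
  refine hC ⟨γ⁻¹ • D, n, hn, hlen, fun j => ?_⟩
  rw [vert_smul, ← hv, vert_smul, RelIso.inv_apply_self]

theorem IsPrimitive.rotate {C : ClosedPath G} (hC : C.IsPrimitive) (k : ℕ) :
    (C.rotate k).IsPrimitive := by
  rintro ⟨D, n, hn, hlen, hv⟩
  -- Rotation by k * len - k undoes rotation by k, since natural indices do not allow -k.
  refine hC ⟨D.rotate (k * C.len - k), n, hn, hlen, fun j => ?_⟩
  have h1 : k ≤ k * C.len := Nat.le_mul_of_pos_right k C.len_pos
  change C.vert j = D.vert (j + (k * C.len - k))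
  rw [← hv]
  change C.vert j = C.vert (j + (k * C.len - k) + k)
  rw [Nat.add_assoc, Nat.sub_add_cancel h1, vert_add_mul]

theorem IsPrimitive.rotate_injOn {C : ClosedPath G} (hC : C.IsPrimitive) {i j : ℕ}
    (hi : i < C.len) (hj : j < C.len) (h : C.rotate i = C.rotate j) : i = j := by
  rw [isPrimitive_iff] at hC
  rw [← hC] at hi hj
  refine Function.iterate_injOn_Iio_minimalPeriod hi hj (funext fun m => ?_)
  change seqShift^[i] C.vert m = seqShift^[j] C.vert m
  rw [seqShift_iterate, seqShift_iterate]
  exact congrFun (congrArg ClosedPath.vert h) m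

theorem rotate_mod (C : ClosedPath G) (k : ℕ) : C.rotate (k % C.len) = C.rotate k := by
  refine ClosedPath.ext rfl (funext fun j => ?_)
  change C.vert (j + k % C.len) = C.vert (j + k)
  rw [← C.vert_mod (j + k % C.len), ← C.vert_mod (j + k), Nat.add_mod_mod]

/-- The cycle of a closed path. -/
def toCycle (C : ClosedPath G) : Cycle G := Quotient.mk (ClosedPath.setoid G) C

theorem toCycle_eq_iff {C D : ClosedPath G} :
    C.toCycle = D.toCycle ↔ D.len = C.len ∧ ∃ k, ∀ j, D.vert j = C.vert (j + k) :=
  Quotient.eq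

theorem toCycle_smul (γ : G ≃g G) (C : ClosedPath G) : (γ • C).toCycle = γ • C.toCycle := rfl

theorem toCycle_rotate (C : ClosedPath G) (k : ℕ) : (C.rotate k).toCycle = C.toCycle :=
  ((toCycle_eq_iff (C := C) (D := C.rotate k)).2 ⟨rfl, k, fun _ => rfl⟩).symm

end ClosedPath

/-! ### Prime cycles modulo the group -/

section Prime

variable {V : Type*} {G : SimpleGraph V}

/-- The primitive reduced closed paths that start in `F`. -/
def PrimitiveFrom (G : SimpleGraph V) (F : Finset V) : Type _ :=
  {C : ClosedPath G // C.IsReduced ∧ C.IsPrimitive ∧ C.vert 0 ∈ F}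

/-- Every reduced closed path is a power of a unique primitive one. -/
def reducedFromEquiv (F : Finset V) : PrimitiveFrom G F × ℕ ≃ ReducedFrom G F where
  toFun p := ⟨p.1.1.power p.2, p.1.2.1.of_vert 0 fun _ => rfl, p.1.2.2.2⟩
  invFun C := ⟨⟨C.1.root, C.2.1.of_vert 0 fun _ => rfl, C.1.root_isPrimitive, C.2.2⟩,
    C.1.len / C.1.period - 1⟩
  left_inv := by
    rintro ⟨⟨C, h1, h2, h3⟩, n⟩
    have hp : C.period = C.len := C.isPrimitive_iff.1 h2
    refine Prod.ext (Subtype.ext (ClosedPath.ext hp rfl)) ?_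
    change (n + 1) * C.len / C.period - 1 = n
    rw [hp, Nat.mul_div_cancel _ C.len_pos, Nat.add_sub_cancel]
  right_inv := by
    rintro ⟨C, h1, h2⟩
    refine Subtype.ext (ClosedPath.ext ?_ rfl)
    change (C.len / C.period - 1 + 1) * C.period = C.len
    rw [Nat.sub_add_cancel, Nat.div_mul_cancel C.period_dvd]
    exact Nat.div_pos (Nat.le_of_dvd C.len_pos C.period_dvd) C.period_pos

theorem Cycle.len_smul (γ : G ≃g G) (c : Cycle G) : (γ • c).len = c.len := by
  obtain ⟨C⟩ := c
  rfl

variable (Γ : Subgroup (G ≃g G))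

/-- The class of a primitive reduced closed path. -/
def PrimitiveFrom.primeClass {F : Finset V} (D : PrimitiveFrom G F) : PrimeClass Γ :=
  Quotient.mk (primeSetoid Γ)
    ⟨D.1.toCycle, D.1, D.2.1, D.2.2.1, rfl⟩

theorem primeClass_eq_iff {F : Finset V} (D : PrimitiveFrom G F) (c : PrimeClass Γ) :
    D.primeClass Γ = c ↔ ∃ γ ∈ Γ, γ • D.1.toCycle =
      (Quotient.out c : PrimeCycle G).1 :=
  Quotient.mk_eq_iff_out

theorem primeClass_len {F : Finset V} {D : PrimitiveFrom G F} {c : PrimeClass Γ}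
    (h : D.primeClass Γ = c) : D.1.len = (Quotient.out c : PrimeCycle G).1.len := by
  obtain ⟨γ, -, h⟩ := (primeClass_eq_iff Γ D c).1 h
  rw [← h, Cycle.len_smul]
  rfl

-- Pairs (D, γ) with γD in the cycle C₀ are counted in two ways. For fixed D the elements γ form a
-- coset of the stabilizer. On the other hand γD is one of the |C₀| distinct rotations of a
-- primitive path D₀, and by freeness exactly one element of Γ carries the origin of a given
-- rotation into F, so the rotation determines γ and D.
variable {Γ} in
theorem card_fiber_mul_card_stabilizer (hfree : ActsFreely Γ) {F : Finset V}
    (hF : IsRepresentatives Γ F) (c : PrimeClass Γ) :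
    Nat.card {D : PrimitiveFrom G F // D.primeClass Γ = c} *
      Nat.card (MulAction.stabilizer Γ (Quotient.out c : PrimeCycle G).1) =
      (Quotient.out c : PrimeCycle G).1.len := by
  set C₀ : Cycle G := (Quotient.out c : PrimeCycle G).1 with hC₀
  obtain ⟨D₀, hred, hprim, hD₀⟩ : C₀.IsPrime := (Quotient.out c : PrimeCycle G).2
  let Z : Type _ := {p : {D : PrimitiveFrom G F // D.primeClass Γ = c} × Γ //
    p.2 • p.1.1.1.toCycle = C₀}
  have hex : ∀ D : {D : PrimitiveFrom G F // D.primeClass Γ = c}, ∃ γ : Γ,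
      γ • D.1.1.toCycle = C₀ := fun D => by
    obtain ⟨γ, hγ, h⟩ := (primeClass_eq_iff Γ D.1 c).1 D.2
    exact ⟨⟨γ, hγ⟩, h⟩
  choose g hg using hex
  let e₁ : Z ≃ {D : PrimitiveFrom G F // D.primeClass Γ = c} × MulAction.stabilizer Γ C₀ :=
    { toFun := fun p => ⟨p.1.1, ⟨p.1.2 * (g p.1.1)⁻¹, by
        have h := p.2
        rw [MulAction.mem_stabilizer_iff, mul_smul, inv_smul_eq_iff.2 (hg p.1.1).symm]
        exact h⟩⟩
      invFun := fun p => ⟨⟨p.1, p.2.1 * g p.1⟩, by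
        change (p.2.1 * g p.1) • _ = C₀
        rw [mul_smul, hg]
        exact p.2.2⟩
      left_inv := fun p => Subtype.ext (Prod.ext rfl (inv_mul_cancel_right _ _))
      right_inv := fun p => Prod.ext rfl (Subtype.ext (mul_inv_cancel_right _ _)) }
  -- Each rotation of D₀ is moved so that its origin lies in F.
  let ψ : Fin D₀.len → Z := fun j =>
    let γ := carry hF (D₀.vert j)
    have hγ : γ ∈ Γ := carry_mem hF _
    have hcyc : γ⁻¹ • (γ • D₀.rotate j).toCycle = C₀ := by
      rw [ClosedPath.toCycle_smul, inv_smul_smul, D₀.toCycle_rotate]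
      exact hD₀
    ⟨⟨⟨⟨γ • D₀.rotate j, (hred.of_vert (D := D₀.rotate j) j fun _ => rfl).smul γ,
        (hprim.rotate j).smul γ, by
          change γ (D₀.vert (0 + j)) ∈ F
          rw [zero_add]; exact carry_apply_mem hF _⟩,
      (primeClass_eq_iff Γ _ c).2 ⟨γ⁻¹, Γ.inv_mem hγ, hcyc⟩⟩, ⟨γ⁻¹, Γ.inv_mem hγ⟩⟩, hcyc⟩
  have hψ : Function.Bijective ψ := by
    constructor
    · intro i j hij
      have h1 : carry hF (D₀.vert i) = carry hF (D₀.vert j) := by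
        have := congrArg (fun p : Z => (p.1.2 : G ≃g G)) hij
        exact inv_injective this
      have h2 : carry hF (D₀.vert i) • D₀.rotate i = carry hF (D₀.vert j) • D₀.rotate j :=
        congrArg (fun p : Z => p.1.1.1.1) hij
      rw [h1] at h2
      exact Fin.ext (hprim.rotate_injOn i.2 j.2 (smul_left_cancel _ h2))
    · rintro ⟨⟨⟨⟨D, hDr, hDp, hDF⟩, hDc⟩, γ, hγ⟩, hp⟩
      have hp' : D₀.toCycle = (γ • D).toCycle := hD₀.trans hp.symm
      obtain ⟨hlen, k, hk⟩ := ClosedPath.toCycle_eq_iff.1 hp'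
      have h1 : γ • D = D₀.rotate (k % D₀.len) := by
        rw [D₀.rotate_mod]
        exact ClosedPath.ext hlen (funext hk)
      have h2 : carry hF (D₀.vert (k % D₀.len)) = γ⁻¹ := by
        refine carry_eq hfree hF (Γ.inv_mem hγ) ?_
        have : γ (D.vert 0) = D₀.vert (k % D₀.len) := by
          have := congrFun (congrArg ClosedPath.vert h1) 0
          change γ (D.vert 0) = D₀.vert (0 + k % D₀.len) at this
          rwa [zero_add] at this
        rw [← this, RelIso.inv_apply_self]
        exact hDF
      refine ⟨⟨k % D₀.len, Nat.mod_lt _ D₀.len_pos⟩, Subtype.ext (Prod.ext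
        (Subtype.ext (Subtype.ext ?_)) (Subtype.ext ?_))⟩
      · change carry hF (D₀.vert (k % D₀.len)) • D₀.rotate (k % D₀.len) = D
        rw [h2, ← h1, inv_smul_smul]
      · change (carry hF (D₀.vert (k % D₀.len)))⁻¹ = γ
        rw [h2, inv_inv]
  rw [← Nat.card_prod, ← Nat.card_congr e₁, ← Nat.card_eq_of_bijective ψ hψ, Nat.card_fin, ← hD₀]
  rfl

end Prime

/-! ### The Euler product -/

section EulerProduct

variable {V : Type*} {G : SimpleGraph V}

theorem hasSum_const_of_finite {α R : Type*} [Finite α] [NonAssocSemiring R] [TopologicalSpace R]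
    (z : R) : HasSum (fun _ : α => z) (Nat.card α * z) := by
  have := Fintype.ofFinite α
  have h := hasSum_fintype (fun _ : α => z)
  rwa [Finset.sum_const, Finset.card_univ, nsmul_eq_mul, ← Nat.card_eq_fintype_card] at h

theorem hasSum_reducedFrom [G.LocallyFinite] (F : Finset V) {u W : ℂ}
    (hW : HasSum (fun m : ℕ => cycleSum G F m * u ^ m / m) W)
    (hs : Summable fun m : ℕ => ‖cycleSum G F m * u ^ m / m‖) :
    HasSum (fun C : ReducedFrom G F => u ^ C.1.len / C.1.len) W := by
  let p : ReducedFrom G F → ℕ := fun C => C.1.len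
  have hempty : IsEmpty {C : ReducedFrom G F // p C = 0} := ⟨fun C => C.1.1.len_pos.ne' C.2⟩
  have hfin : ∀ m, Finite {C : ReducedFrom G F // p C = m} := by
    intro m
    rcases m.eq_zero_or_pos with rfl | hm
    · infer_instance
    · exact (finite_card_reducedFrom G F hm).1
  have hcard : ∀ m : ℕ, Nat.card {C : ReducedFrom G F // p C = m} * (u ^ m / m) =
      cycleSum G F m * u ^ m / m := by
    intro m
    rcases m.eq_zero_or_pos with rfl | hm
    · simp
    · rw [mul_div_assoc, ← (finite_card_reducedFrom G F hm).2]
  have hconst : ∀ m, (fun C : {C : ReducedFrom G F // p C = m} =>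
      u ^ C.1.1.len / C.1.1.len) = fun _ => u ^ m / m := fun m => funext fun C => by
    rw [show C.1.1.len = m from C.2]
  have hfib : ∀ m, HasSum (fun C : {C : ReducedFrom G F // p C = m} =>
      u ^ C.1.1.len / C.1.1.len) (cycleSum G F m * u ^ m / m) := by
    intro m
    have := hfin m
    rw [← hcard, hconst]
    exact hasSum_const_of_finite _
  -- Regrouping by length; each fibre has constant terms, so absolute summability reduces to that of
  -- the series in m.
  rw [← (Equiv.sigmaFiberEquiv p).hasSum_iff]
  refine HasSum.sigma_of_hasSum hW hfib (Summable.of_norm ?_)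
  refine (summable_sigma_of_nonneg fun _ => norm_nonneg _).2 ⟨fun m => ?_, ?_⟩
  · have := hfin m
    exact Summable.of_finite
  · refine hs.congr fun m => ?_
    have := hfin m
    have h1 : (fun C : {C : ReducedFrom G F // p C = m} => ‖u ^ C.1.1.len / C.1.1.len‖) =
        fun _ => ‖u ^ m / m‖ := funext fun C => congrArg norm (congrFun (hconst m) C)
    refine Eq.trans ?_ (congrArg tsum h1).symm
    rw [(hasSum_const_of_finite _).tsum_eq, ← hcard, norm_mul, Complex.norm_natCast]

/-- With ℓ = |D|, the powers of D contribute ∑ u^{kℓ}/(kℓ) = -log(1 - u^ℓ)/ℓ. -/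
theorem hasSum_primitiveFrom (F : Finset V) {u W : ℂ} (hu : ‖u‖ < 1)
    (hW : HasSum (fun C : ReducedFrom G F => u ^ C.1.len / C.1.len) W) :
    HasSum (fun D : PrimitiveFrom G F => -Complex.log (1 - u ^ D.1.len) / D.1.len) W := by
  rw [← (reducedFromEquiv F).hasSum_iff] at hW
  refine hW.prod_fiberwise fun D => ?_
  have hlen := D.1.len_pos
  have h1 := Complex.hasSum_taylorSeries_neg_log (z := u ^ D.1.len)
    (by rw [norm_pow]; exact pow_lt_one₀ (norm_nonneg u) hu hlen.ne')
  -- Index n stands for the (n+1)-fold power, so the zeroth term of the series is dropped.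
  rw [← hasSum_nat_add_iff' 1] at h1
  have h2 := h1.div_const (D.1.len : ℂ)
  simp only [Finset.range_one, Finset.sum_singleton, Nat.cast_zero, div_zero, sub_zero] at h2
  convert! h2 using 1
  funext k
  change u ^ ((k + 1) * D.1.len) / (((k + 1) * D.1.len : ℕ) : ℂ) = _
  rw [mul_comm (k + 1), pow_mul, Nat.cast_mul, mul_comm (D.1.len : ℂ), div_div]

/-- A class with k representatives contributes -k log(1 - u^ℓ)/ℓ, and k/ℓ = 1/|Γ_C|. This is the
exponent in the principal power, so exponentiating the unconditional sum gives the unconditional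
product. -/
theorem hasProd_zetaFactor {Γ : Subgroup (G ≃g G)} (hfree : ActsFreely Γ) {F : Finset V}
    (hF : IsRepresentatives Γ F) {u W : ℂ} (hu : ‖u‖ < 1)
    (hW : HasSum (fun C : ReducedFrom G F => u ^ C.1.len / C.1.len) W) :
    HasProd (zetaFactor Γ u) (Complex.exp W) := by
  have hD := hasSum_primitiveFrom F hu hW
  let p : PrimitiveFrom G F → PrimeClass Γ := PrimitiveFrom.primeClass Γ
  rw [← (Equiv.sigmaFiberEquiv p).hasSum_iff] at hD
  have hsum : HasSum (fun c : PrimeClass Γ =>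
      Complex.log (1 - u ^ (Quotient.out c : PrimeCycle G).1.len) *
        (-(1 / (Nat.card (MulAction.stabilizer Γ (Quotient.out c : PrimeCycle G).1) : ℂ)))) W := by
    refine hD.sigma fun c => ?_
    have hcard := card_fiber_mul_card_stabilizer hfree hF c
    have hlen : 0 < (Quotient.out c : PrimeCycle G).1.len := by
      obtain ⟨D, -, -, h⟩ := (Quotient.out c : PrimeCycle G).2
      rw [← h]
      exact D.len_pos
    set ℓ := (Quotient.out c : PrimeCycle G).1.len with hℓ
    set n := Nat.card (MulAction.stabilizer Γ (Quotient.out c : PrimeCycle G).1) with hn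
    -- `Nat.card` is 0 for infinite types, so the positive product shows that the fibre and the
    -- stabilizer are finite.
    have hk0 : Nat.card {D : PrimitiveFrom G F // p D = c} ≠ 0 :=
      left_ne_zero_of_mul (hcard.trans_ne hlen.ne')
    have hn0 : n ≠ 0 := right_ne_zero_of_mul (hcard.trans_ne hlen.ne')
    have := Nat.finite_of_card_ne_zero hk0
    have hconst : (fun D : {D : PrimitiveFrom G F // p D = c} =>
        -Complex.log (1 - u ^ D.1.1.len) / D.1.1.len) =
        fun _ => -Complex.log (1 - u ^ ℓ) / ℓ := funext fun D => by
      rw [primeClass_len Γ D.2]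
    have h2 : Complex.log (1 - u ^ ℓ) * (-(1 / (n : ℂ))) =
        Nat.card {D : PrimitiveFrom G F // p D = c} * (-Complex.log (1 - u ^ ℓ) / ℓ) := by
      have h3 : (Nat.card {D : PrimitiveFrom G F // p D = c} : ℂ) * n = ℓ := by exact_mod_cast hcard
      have hn1 : (n : ℂ) ≠ 0 := by exact_mod_cast hn0
      have hk1 : (Nat.card {D : PrimitiveFrom G F // p D = c} : ℂ) ≠ 0 := by exact_mod_cast hk0
      rw [← h3]
      field_simp
    rw [h2]
    have h4 := hasSum_const_of_finite (α := {D : PrimitiveFrom G F // p D = c})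
      (-Complex.log (1 - u ^ ℓ) / ℓ)
    rw [← hconst] at h4
    exact h4
  convert! hsum.cexp using 1
  funext c
  have hlen : 0 < (Quotient.out c : PrimeCycle G).1.len := by
    obtain ⟨D, -, -, h⟩ := (Quotient.out c : PrimeCycle G).2
    rw [← h]
    exact D.len_pos
  rw [zetaFactor, Complex.cpow_def_of_ne_zero]
  · rfl
  · intro h
    have h1 : ‖u ^ (Quotient.out c : PrimeCycle G).1.len‖ < 1 := by
      rw [norm_pow]; exact pow_lt_one₀ (norm_nonneg u) hu hlen.ne'
    rw [← sub_eq_zero.1 h] at h1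
    simp at h1

end EulerProduct

/-! ### The Euler characteristic of the quotient -/

section Euler

variable {V : Type*} {G : SimpleGraph V} {Γ : Subgroup (G ≃g G)}

theorem card_quotVertex {F : Finset V} (hF : IsRepresentatives Γ F) :
    Nat.card (QuotVertex Γ) = F.card := by
  rw [← Nat.card_eq_finsetCard F]
  refine (Nat.card_eq_of_bijective
    (fun x : F => (Quotient.mk (vertexSetoid Γ) x.1 : QuotVertex Γ)) ⟨?_, ?_⟩).symm
  · intro x y h
    obtain ⟨γ, hγ, h⟩ := Quotient.exact h
    exact Subtype.ext ((hF x.1).unique ⟨x.2, 1, Γ.one_mem, rfl⟩ ⟨y.2, γ, hγ, h⟩)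
  · rintro ⟨x⟩
    exact ⟨⟨carry hF x x, carry_apply_mem hF x⟩,
      (Quotient.sound ⟨carry hF x, carry_mem hF x, rfl⟩ :
        Quotient.mk (vertexSetoid Γ) x = _).symm⟩

/-- Each of the two orientations of an edge of the quotient lifts to a unique oriented edge of the
graph that starts in F, and there are |F|(q+1) of those. -/
theorem card_quotEdge_mul_two [G.LocallyFinite] (hfree : ActsFreely Γ) {F : Finset V}
    (hF : IsRepresentatives Γ F) {q : ℕ} (hG : G.IsRegularOfDegree (q + 1)) :
    Nat.card (QuotEdge Γ) * 2 = F.card * (q + 1) := by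
  have hex : ∀ c : QuotEdge Γ, ∃ a b : V, ∃ h : G.Adj a b,
      (Quotient.mk (edgeSetoid Γ) ⟨s(a, b), h⟩ : QuotEdge Γ) = c := by
    rintro ⟨e, he⟩
    induction e with
    | _ a b => exact ⟨a, b, he, rfl⟩
  choose a b hab hc using hex
  let s : QuotEdge Γ × Bool → V := fun p => bif p.2 then a p.1 else b p.1
  let t : QuotEdge Γ × Bool → V := fun p => bif p.2 then b p.1 else a p.1
  have hst : ∀ p, s(s p, t p) = s(a p.1, b p.1) := by
    rintro ⟨c, i⟩
    cases i
    · exact Sym2.eq_swap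
    · rfl
  have hadj : ∀ p, G.Adj (s p) (t p) := by
    rintro ⟨c, i⟩
    cases i
    · exact (hab c).symm
    · exact hab c
  let ψ : QuotEdge Γ × Bool → Σ x : F, G.neighborFinset x.1 := fun p =>
    ⟨⟨carry hF (s p) (s p), carry_apply_mem hF _⟩, ⟨carry hF (s p) (t p),
      (G.mem_neighborFinset _ _).2 ((RelIso.map_rel_iff (carry hF (s p))).2 (hadj p))⟩⟩
  have hψ : Function.Bijective ψ := by
    constructor
    · intro p p' h
      have h1 : carry hF (s p) (s p) = carry hF (s p') (s p') := congrArg (fun z => z.1.1) h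
      have h2 : carry hF (s p) (t p) = carry hF (s p') (t p') := congrArg (fun z => z.2.1) h
      set δ := (carry hF (s p'))⁻¹ * carry hF (s p) with hδ
      have hδΓ : δ ∈ Γ := Γ.mul_mem (Γ.inv_mem (carry_mem hF _)) (carry_mem hF _)
      have h3 : δ (s p) = s p' := by
        rw [hδ, RelIso.mul_apply, h1, RelIso.inv_apply_self]
      have h4 : δ (t p) = t p' := by
        rw [hδ, RelIso.mul_apply, h2, RelIso.inv_apply_self]
      have hcc : p.1 = p'.1 := by
        rw [← hc p.1, ← hc p'.1]
        refine Quotient.sound ⟨δ, hδΓ, ?_⟩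
        change Sym2.map δ s(a p.1, b p.1) = s(a p'.1, b p'.1)
        rw [← hst, ← hst, Sym2.map_mk, h3, h4]
      refine Prod.ext hcc ?_
      by_contra hne
      have hsw : s p' = t p ∧ t p' = s p := by
        obtain ⟨c, i⟩ := p
        obtain ⟨c', i'⟩ := p'
        obtain rfl : c = c' := hcc
        cases i <;> cases i' <;> first | exact absurd rfl hne | exact ⟨rfl, rfl⟩
      -- If both orientations had the same lift, δ would invert a geometric edge; freeness on edges
      -- forces δ = 1, and then the ends of the edge coincide.
      have hδ1 : δ = 1 := by
        by_contra hδ1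
        refine (hfree δ hδΓ hδ1).2 s(s p, t p) (hadj p) ?_
        rw [Sym2.map_mk, h3, h4, hsw.1, hsw.2]
        exact Sym2.eq_swap
      rw [hδ1] at h3
      exact (hadj p).ne (Eq.trans h3 hsw.1)
    · rintro ⟨⟨x, hx⟩, ⟨y, hy⟩⟩
      have hxy := (G.mem_neighborFinset x y).1 hy
      obtain ⟨γ, hγ, h⟩ := Quotient.exact (hc (Quotient.mk (edgeSetoid Γ) ⟨s(x, y), hxy⟩))
      set c : QuotEdge Γ := Quotient.mk (edgeSetoid Γ) ⟨s(x, y), hxy⟩ with hcdef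
      change Sym2.map γ s(a c, b c) = s(x, y) at h
      have hp : ∃ p, γ (s p) = x ∧ γ (t p) = y := by
        rw [Sym2.map_mk, Sym2.eq_iff] at h
        rcases h with h | h
        · exact ⟨(c, true), h⟩
        · exact ⟨(c, false), h.symm⟩
      obtain ⟨p, rfl, rfl⟩ := hp
      refine ⟨p, ?_⟩
      have : carry hF (s p) = γ := carry_eq hfree hF hγ hx
      subst this
      rfl
  have h1 := Nat.card_eq_of_bijective ψ hψ
  rw [Nat.card_prod, Nat.card_sigma] at h1
  have h2 : ∀ x : F, Nat.card (G.neighborFinset x.1) = q + 1 := fun x => by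
    rw [Nat.card_eq_finsetCard, card_neighborFinset_of_regular hG]
  rw [Finset.sum_congr rfl fun x _ => h2 x] at h1
  simpa using h1

theorem eulerChar_eq [G.LocallyFinite] (hfree : ActsFreely Γ) {F : Finset V}
    (hF : IsRepresentatives Γ F) {q : ℕ} (hG : G.IsRegularOfDegree (q + 1)) :
    (eulerChar Γ : ℂ) = (F.card : ℂ) * (1 - (q : ℂ)) / 2 := by
  have h : (Nat.card (QuotEdge Γ) : ℂ) * 2 = F.card * (q + 1) := by
    exact_mod_cast card_quotEdge_mul_two hfree hF hG
  rw [eulerChar, card_quotVertex hF]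
  push_cast
  linear_combination (-1 / 2) * h

theorem l2EulerChar_eq [G.LocallyFinite] (F : Finset V) {q : ℕ}
    (hG : G.IsRegularOfDegree (q + 1)) :
    l2EulerChar G (q + 1) (fun v => (hG v).le) F = (F.card : ℂ) * (1 - (q : ℂ)) / 2 := by
  classical
  have h : trace F (degOp G (q + 1) (fun v => (hG v).le) - 1) = F.card * ((q : ℂ) - 1) := by
    rw [trace_sub, trace_one, trace]
    have : ∀ x ∈ F, degOp G (q + 1) (fun v => (hG v).le) (lp.single 2 x (1 : ℂ)) x = q := by
      intro x _
      change ((G.degree x : ℂ) - 1) * (lp.single 2 x (1 : ℂ) : L2 V) x = q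
      rw [hG x]
      simp
    rw [Finset.sum_congr rfl this, Finset.sum_const, nsmul_eq_mul]
    ring
  rw [l2EulerChar, h]
  ring

end Euler

/-! ### Comparison of the Euler product with the determinant -/

section Main

variable {V : Type*} (G : SimpleGraph V) [G.LocallyFinite] {Γ : Subgroup (G ≃g G)}

theorem deformedLaplacian_mem_groupAlg {q : ℕ} (hG : G.IsRegularOfDegree (q + 1)) (u : ℂ) :
    deformedLaplacian G q hG u ∈ groupAlg Γ :=
  sub_mem (Subalgebra.smul_mem _ (one_mem _) _)
    (Subalgebra.smul_mem _ (adjOp_mem_groupAlg G (q + 1) _ Γ) _)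

/-- The counts and the traces differ only for even m, and this difference sums to χ(B) log(1 - u²).
-/
theorem hasProd_zetaFactor_determinant (hfree : ActsFreely Γ) {F : Finset V}
    (hF : IsRepresentatives Γ F) {q : ℕ} (hq : 1 ≤ q) (hG : G.IsRegularOfDegree (q + 1)) {u : ℂ}
    (hu : ‖u‖ < 1 / (q : ℝ)) :
    HasProd (zetaFactor Γ u) ((1 - u ^ 2) ^ eulerChar Γ *
      (analyticDet (trace F) (deformedLaplacian G q hG u))⁻¹) := by
  have hq' : (1 : ℝ) ≤ q := by exact_mod_cast hq
  have hu1 : ‖u‖ < 1 := hu.trans_le ((div_le_one (by positivity)).2 hq')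
  have hne : ∀ z : ℂ, ‖z‖ < 1 → 1 - z ≠ 0 := fun z hz h => by
    rw [← sub_eq_zero.1 h] at hz
    simp at hz
  obtain ⟨W, hW, hdet⟩ := exists_hasSum_analyticDet G hq hG F hu
  have h1 := Complex.hasSum_taylorSeries_neg_log hu1
  have h2 := Complex.hasSum_taylorSeries_neg_log (z := -u) (by rwa [norm_neg])
  -- Adding the series at u and -u selects the even exponents.
  have h3 := (h1.add h2).mul_left (F.card * ((q : ℂ) - 1) / 2)
  have hterm : (fun m : ℕ => cycleSum G F m * u ^ m / m) = fun m : ℕ =>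
      trace F (powerSum q (adjOp G (q + 1) fun v => (hG v).le) m) * u ^ m / m +
        F.card * ((q : ℂ) - 1) / 2 * (u ^ m / m + (-u) ^ m / m) := by
    funext m
    cases m with
    | zero => simp
    | succ m => rw [cycleSum_eq_trace G hfree hF hG, neg_pow u]; ring
  have hsum := hW.add h3
  rw [← hterm] at hsum
  convert! hasProd_zetaFactor hfree hF hu1 (hasSum_reducedFrom F hsum hsum.summable.norm) using 1
  -- The coefficient is the integer χ(B), so exponentiation gives an integer power and no branch
  -- matters.
  have h4 : (F.card : ℂ) * ((q : ℂ) - 1) / 2 * (-Complex.log (1 - u) + -Complex.log (1 - -u)) =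
      (eulerChar Γ : ℂ) * (Complex.log (1 - u) + Complex.log (1 - -u)) := by
    rw [eulerChar_eq hfree hF hG]; ring
  rw [Complex.exp_add, h4, Complex.exp_int_mul, Complex.exp_add, Complex.exp_log (hne _ hu1),
    Complex.exp_log (hne _ (by rwa [norm_neg])), hdet, Complex.exp_neg, inv_inv, mul_comm]
  congr 2
  ring

end Main

end PeriodicGraph

end

theorem mainTheorem5 {V : Type*} [Countable V] (G : SimpleGraph V) [G.LocallyFinite]
    (q : ℕ) (hq : 1 ≤ q) (hG : G.IsRegularOfDegree (q + 1))
    (Γ : Subgroup (G ≃g G)) (hfree : PeriodicGraph.ActsFreely Γ)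
    (F : Finset V) (hF : PeriodicGraph.IsRepresentatives Γ F) :
    -- all `Δ(u)` belong to the von Neumann algebra on which the determinant is considered
    (∀ u : ℂ, PeriodicGraph.deformedLaplacian G q hG u ∈ PeriodicGraph.groupAlg Γ) ∧
    -- (i)
    (PeriodicGraph.l2EulerChar G (q + 1) (fun v => (hG v).le) F = (PeriodicGraph.eulerChar Γ : ℂ) ∧
      (PeriodicGraph.eulerChar Γ : ℂ) =
        (Nat.card (PeriodicGraph.QuotVertex Γ) : ℂ) * (1 - (q : ℂ)) / 2) ∧
    -- (ii)
    (∀ u : ℂ, ‖u‖ < 1 / (q : ℝ) →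
      Multipliable (PeriodicGraph.zetaFactor Γ u) ∧
      PeriodicGraph.zeta Γ u = (1 - u ^ 2) ^ PeriodicGraph.eulerChar Γ *
        (PeriodicGraph.analyticDet (PeriodicGraph.trace F)
          (PeriodicGraph.deformedLaplacian G q hG u))⁻¹) ∧
    -- (iii)
    (Metric.ball (0 : ℂ) (1 / (q : ℝ)) ⊆ PeriodicGraph.holomorphyDomain q ∧
      IsOpen (PeriodicGraph.holomorphyDomain q) ∧
      (∀ u ∈ PeriodicGraph.holomorphyDomain q,
        (0 : ℂ) ∉ convexHull ℝ (spectrum ℂ (PeriodicGraph.deformedLaplacian G q hG u))) ∧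
      DifferentiableOn ℂ
        (fun u => (1 - u ^ 2) ^ PeriodicGraph.eulerChar Γ *
          (PeriodicGraph.analyticDet (PeriodicGraph.trace F)
            (PeriodicGraph.deformedLaplacian G q hG u))⁻¹)
        (PeriodicGraph.holomorphyDomain q)) ∧
    -- (iv)
    (∀ u ∈ PeriodicGraph.holomorphyDomain q, u ≠ 0 →
      1 / ((q : ℂ) * u) ∈ PeriodicGraph.holomorphyDomain q ∧
      PeriodicGraph.analyticDet (PeriodicGraph.trace F)
          (PeriodicGraph.deformedLaplacian G q hG (1 / ((q : ℂ) * u))) =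
        ((q : ℂ) * u ^ 2) ^ (-(Nat.card (PeriodicGraph.QuotVertex Γ) : ℤ)) *
          PeriodicGraph.analyticDet (PeriodicGraph.trace F)
            (PeriodicGraph.deformedLaplacian G q hG u)) := by
  have hcard := PeriodicGraph.card_quotVertex hF
  have hχ := PeriodicGraph.eulerChar_eq hfree hF hG
  refine ⟨PeriodicGraph.deformedLaplacian_mem_groupAlg G hG, ⟨?_, ?_⟩, fun u hu => ?_,
    ⟨PeriodicGraph.ball_subset_holomorphyDomain hq, PeriodicGraph.isOpen_holomorphyDomain q,
      fun u hu => PeriodicGraph.zero_notMem_convexHull_spectrum G hq hG hu,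
      PeriodicGraph.differentiableOn_zeta_extension G hq hG F _⟩, fun u hu hu0 => ⟨?_, ?_⟩⟩
  · rw [PeriodicGraph.l2EulerChar_eq F hG, hχ]
  · rw [hχ, hcard]
  · have h := PeriodicGraph.hasProd_zetaFactor_determinant G hfree hF hq hG hu
    exact ⟨h.multipliable, h.tprod_eq⟩
  · exact PeriodicGraph.one_div_mem_holomorphyDomain hq hu hu0
  · rw [hcard]
    exact PeriodicGraph.analyticDet_functional_equation G hq hG F hu hu0
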